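/- Let $P$ be a finite set of points in the plane, possibly with three or more collinear points. A point of $P$ is a \emph{hull point} if it lies on the boundary of the convex hull of $P$ (it need not be a vertex of the hull), and an \emph{internal point} if it lies in the interior of the convex hull. A \emph{triangulation} of $P$ is a maximal set of segments joining two points of $P$, none of them passing through a further point of $P$, such that no two of them meet in a point that is not a common endpoint. The \emph{triangles} of a triangulation are its triangular bounded faces. Point sets $P$ and $Q$ \emph{have compatible triangulations} if there are triangulations $T_P$ of $P$ and $T_Q$ of $Q$ and a bijection $\phi : P \to Q$ such that $abc$ is a clockwise-ordered triangle of $T_P$ if and only if $\phi(a)\phi(b)\phi(c)$ is a clockwise-ordered triangle of $T_Q$. (i) Let $P$ and $Q$ be finite planar point sets with the same number of points and the same number of hull points, each having exactly one or exactly two internal points. Then $P$ and $Q$ have compatible triangulations. (ii) Let $P$ and $Q$ be planar point sets with the same number $n \le 5$ of points and the same number of hull points, neither of them contained in a line. Then $P$ and $Q$ have compatible triangulations. (iii) The bound in (ii) is best possible: there are two planar sets of $6$ points, neither contained in a line, with the same number of hull points, that do not have compatible triangulations. -/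

import Mathlib

/-- The Euclidean plane. -/
abbrev Plane : Type := EuclideanSpace ℝ (Fin 2)

/-- The points of `P` on the boundary of the convex hull of `P`
(the vertices of the hull and the points of `P` in the relative interior of hull edges). -/
def hullPoints (P : Finset Plane) : Set Plane :=
  {p | p ∈ P ∧ p ∈ frontier (convexHull ℝ (P : Set Plane))}

/-- The points of `P` in the interior of the convex hull of `P`. -/
def internalPoints (P : Finset Plane) : Set Plane :=
  {p | p ∈ P ∧ p ∈ interior (convexHull ℝ (P : Set Plane))}

/-- `a b c` are not collinear and occur in clockwise order (negative signed area). -/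
def Clockwise (a b c : Plane) : Prop :=
  (b 0 - a 0) * (c 1 - a 1) - (b 1 - a 1) * (c 0 - a 0) < 0

/-- A set of segments between points of `P`, given as a simple graph on `P`, such that
no segment passes through a further point of `P`, and no two different segments meet in a point
that is not a common endpoint. -/
structure IsNoncrossing (P : Finset Plane) (G : SimpleGraph P) : Prop where
  no_point : ∀ a b p : P, G.Adj a b → (p : Plane) ∉ openSegment ℝ (a : Plane) (b : Plane)
  no_cross : ∀ a b c d : P, G.Adj a b → G.Adj c d → s(a, b) ≠ s(c, d) →
    ∀ x : Plane, x ∈ segment ℝ (a : Plane) (b : Plane) → x ∈ segment ℝ (c : Plane) (d : Plane) →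
      (x = a ∨ x = b) ∧ (x = c ∨ x = d)

/-- A triangulation of `P` is a maximal noncrossing set of segments between points of `P`. -/
def IsTriangulation (P : Finset Plane) (T : SimpleGraph P) : Prop :=
  Maximal (IsNoncrossing P) T

/-- `a b c` is a clockwise-ordered triangle (a triangular face) of `T`: the three sides belong
to `T`, and the closed triangle contains no further point of `P`. -/
structure IsClockwiseTriangle {P : Finset Plane} (T : SimpleGraph P) (a b c : P) : Prop where
  adj_ab : T.Adj a b
  adj_bc : T.Adj b c
  adj_ca : T.Adj c a
  clockwise : Clockwise a b c
  is_face : ∀ p : P, (p : Plane) ∈ convexHull ℝ {(a : Plane), (b : Plane), (c : Plane)} →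
    p = a ∨ p = b ∨ p = c

/-- Two triangulations are compatible if some bijection of the point sets preserves and reflects
clockwise-ordered triangles. -/
def Compatible {P Q : Finset Plane} (S : SimpleGraph P) (T : SimpleGraph Q) : Prop :=
  ∃ φ : P ≃ Q, ∀ a b c : P,
    IsClockwiseTriangle S a b c ↔ IsClockwiseTriangle T (φ a) (φ b) (φ c)

/-- `P` and `Q` have compatible triangulations. -/
def HaveCompatibleTriangulations (P Q : Finset Plane) : Prop :=
  ∃ (S : SimpleGraph P) (T : SimpleGraph Q),
    IsTriangulation P S ∧ IsTriangulation Q T ∧ Compatible S T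

/-! For the positive statements, one abstract list of faces serves all point sets with the given
numbers of hull and internal points. Let `h 0, …, h (m - 1)` be the hull points in counterclockwise
order, with `h m = h 0`. A single internal point is joined to every hull point. Two internal points
`p`, `q` are joined to each other, `p` to three consecutive hull points `h 0, h 1, h 2`, and `q` to
`h 2, …, h m`. This is a triangulation once the direction from `q` to `p` lies between those of `h
0` and `h 2` and within a half turn of each; `DoubleStar.exists_of_internalPoints` finds such a
numbering. With no internal point and `m ≤ 5`, all diagonals start at one hull point, chosen so that
both its neighbours are genuine corners (`HullCycle.exists_fan`). A noncollinear set has at least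
three hull points, so at most five points leave at most two internal ones, and these cases suffice.

That a face list comes from a triangulation is a local check, collected in `FaceSystem`: faces are
clockwise and empty, and each side has a face across it or supports the whole set. Noncrossing is
easy because every edge off the hull has an end at one of two centres. A directed edge lies in at
most one clockwise triangle, so the triangles of the graph are exactly the listed faces. The graph
is maximal because a further segment would leave its endpoint through the angle of some face and
cross the far side. `haveCompatibleTriangulations_of_labels` then matches two realisations of one
list.

The cyclic order of the hull comes from sorting directions at an interior point
(`exists_hullCycle`). The angles are unrolled to an increasing real sequence, so positions of rays
become inequalities between reals.

For the counterexample, in each of two six-point sets the segments free of further points never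
cross, so the triangulation is unique. In one of them two vertices of a face together meet every
face; in the other no two vertices of a face do. -/

/-! ### Coordinates in the plane -/

/-- Twice the signed area of the triangle `a b c`. -/
def signedArea (a b c : Plane) : ℝ :=
  (b 0 - a 0) * (c 1 - a 1) - (b 1 - a 1) * (c 0 - a 0)

theorem clockwise_iff {a b c : Plane} : Clockwise a b c ↔ signedArea a b c < 0 := Iff.rfl

theorem Plane.ext {a b : Plane} (h0 : a 0 = b 0) (h1 : a 1 = b 1) : a = b := by
  ext i; fin_cases i <;> assumption

theorem normSq_sub_pos {a b : Plane} (h : a ≠ b) : 0 < (b 0 - a 0) ^ 2 + (b 1 - a 1) ^ 2 := by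
  by_contra hcon
  have z0 : b 0 - a 0 = 0 := by nlinarith [sq_nonneg (b 0 - a 0), sq_nonneg (b 1 - a 1)]
  have z1 : b 1 - a 1 = 0 := by nlinarith [sq_nonneg (b 0 - a 0), sq_nonneg (b 1 - a 1)]
  exact h (Plane.ext (by linarith) (by linarith))

theorem exists_param_of_signedArea_eq_zero {a b z : Plane} (hab : a ≠ b)
    (hz : signedArea a b z = 0) :
    ∃ r : ℝ, z 0 = a 0 + r * (b 0 - a 0) ∧ z 1 = a 1 + r * (b 1 - a 1) := by
  have hN := (normSq_sub_pos hab).ne'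
  refine ⟨((z 0 - a 0) * (b 0 - a 0) + (z 1 - a 1) * (b 1 - a 1)) /
    ((b 0 - a 0) ^ 2 + (b 1 - a 1) ^ 2), ?_, ?_⟩
  · field_simp; unfold signedArea at hz; linear_combination -(b 1 - a 1) * hz
  · field_simp; unfold signedArea at hz; linear_combination (b 0 - a 0) * hz

theorem signedArea_rotate (a b c : Plane) : signedArea b c a = signedArea a b c := by
  unfold signedArea; ring

theorem signedArea_swap (a b c : Plane) : signedArea b a c = -signedArea a b c := by
  unfold signedArea; ring

theorem signedArea_swap_right (a b c : Plane) : signedArea a c b = -signedArea a b c := by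
  unfold signedArea; ring

@[simp] theorem signedArea_self_left (a b : Plane) : signedArea a a b = 0 := by
  unfold signedArea; ring

@[simp] theorem signedArea_self_right (a b : Plane) : signedArea a b b = 0 := by
  unfold signedArea; ring

@[simp] theorem signedArea_self_outer (a b : Plane) : signedArea a b a = 0 := by
  unfold signedArea; ring

theorem Clockwise.rotate {a b c : Plane} (h : Clockwise a b c) : Clockwise b c a := by
  rw [clockwise_iff] at *; rwa [signedArea_rotate]

theorem Clockwise.ne {a b c : Plane} (h : Clockwise a b c) : a ≠ b := by
  rintro rfl; simp [clockwise_iff] at h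

theorem mem_segment_iff_coord {a b x : Plane} : x ∈ segment ℝ a b ↔
    ∃ t : ℝ, 0 ≤ t ∧ t ≤ 1 ∧ x 0 = a 0 + t * (b 0 - a 0) ∧ x 1 = a 1 + t * (b 1 - a 1) := by
  rw [segment_eq_image']
  constructor
  · rintro ⟨t, ⟨h0, h1⟩, rfl⟩
    exact ⟨t, h0, h1, by simp, by simp⟩
  · rintro ⟨t, h0, h1, hx, hy⟩
    exact ⟨t, ⟨h0, h1⟩, Plane.ext (by simp [hx]) (by simp [hy])⟩

theorem mem_openSegment_iff_coord {a b x : Plane} : x ∈ openSegment ℝ a b ↔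
    ∃ t : ℝ, 0 < t ∧ t < 1 ∧ x 0 = a 0 + t * (b 0 - a 0) ∧ x 1 = a 1 + t * (b 1 - a 1) := by
  rw [openSegment_eq_image']
  constructor
  · rintro ⟨t, ⟨h0, h1⟩, rfl⟩
    exact ⟨t, h0, h1, by simp, by simp⟩
  · rintro ⟨t, h0, h1, hx, hy⟩
    exact ⟨t, ⟨h0, h1⟩, Plane.ext (by simp [hx]) (by simp [hy])⟩

theorem mem_convexHull_triple_iff_coord {a b c x : Plane} :
    x ∈ convexHull ℝ {a, b, c} ↔ ∃ β γ : ℝ, 0 ≤ β ∧ 0 ≤ γ ∧ β + γ ≤ 1 ∧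
      x 0 = a 0 + β * (b 0 - a 0) + γ * (c 0 - a 0) ∧
      x 1 = a 1 + β * (b 1 - a 1) + γ * (c 1 - a 1) := by
  constructor
  · rw [convexHull_insert (by simp), convexHull_pair]
    simp only [convexJoin, Set.mem_iUnion, Set.mem_singleton_iff, exists_prop, exists_eq_left]
    rintro ⟨y, hy, hx⟩
    obtain ⟨t, t0, t1, h0, h1⟩ := mem_segment_iff_coord.1 hy
    obtain ⟨s, s0, s1, g0, g1⟩ := mem_segment_iff_coord.1 hx
    refine ⟨s * (1 - t), s * t, mul_nonneg s0 (by linarith), mul_nonneg s0 t0, by linarith, ?_, ?_⟩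
    · rw [g0, h0]; ring
    · rw [g1, h1]; ring
  · rintro ⟨β, γ, hβ, hγ, h, h0, h1⟩
    have e : x = (1 - β - γ) • a + β • b + γ • c :=
      Plane.ext (by simp [h0]; ring) (by simp [h1]; ring)
    have hc := convex_convexHull ℝ ({a, b, c} : Set Plane)
    have ha : a ∈ convexHull ℝ ({a, b, c} : Set Plane) := subset_convexHull _ _ (by simp)
    have hb : b ∈ convexHull ℝ ({a, b, c} : Set Plane) := subset_convexHull _ _ (by simp)
    have hd : c ∈ convexHull ℝ ({a, b, c} : Set Plane) := subset_convexHull _ _ (by simp)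
    have := hc.sum_mem (t := Finset.univ) (w := ![1 - β - γ, β, γ]) (z := ![a, b, c])
      (by intro i _; fin_cases i <;> simp <;> linarith)
      (by simp [Fin.sum_univ_three]; ring)
      (by intro i _; fin_cases i <;> simp <;> assumption)
    rw [e]
    simpa [Fin.sum_univ_three] using this

/-- A point in the open cone at `a` spanned by `b` and `c` is in the triangle `a b c`, or it is
separated from `a` by the side `b c`. -/
theorem mem_triangle_or_crosses {a b c x : Plane} {σ : ℝ} (h1 : 0 < σ * signedArea a b x)
    (h2 : 0 < σ * signedArea a x c) (h : 0 < σ * signedArea a b c) :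
    x ∈ convexHull ℝ {a, b, c} ∨ ∃ y, y ∈ openSegment ℝ a x ∧ y ∈ openSegment ℝ b c := by
  have hσ : σ ≠ 0 := by rintro rfl; simp at h
  have hD : signedArea a b c ≠ 0 := by intro e; simp [e] at h
  set D := signedArea a b c with hDdef
  -- Cramer's rule for `x - a` in the basis `b - a`, `c - a`. Both coordinates are positive, so the
  -- only question is whether their sum exceeds 1.
  set β := signedArea a x c / D with hβ
  set γ := signedArea a b x / D with hγ
  have hβ0 : 0 < β := by
    have : β = (σ * signedArea a x c) / (σ * D) := by rw [hβ]; field_simp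
    rw [this]; positivity
  have hγ0 : 0 < γ := by
    have : γ = (σ * signedArea a b x) / (σ * D) := by rw [hγ]; field_simp
    rw [this]; positivity
  have e0 : x 0 = a 0 + β * (b 0 - a 0) + γ * (c 0 - a 0) := by
    rw [hβ, hγ]; field_simp; rw [hDdef]; unfold signedArea; ring
  have e1 : x 1 = a 1 + β * (b 1 - a 1) + γ * (c 1 - a 1) := by
    rw [hβ, hγ]; field_simp; rw [hDdef]; unfold signedArea; ring
  rcases le_or_gt (β + γ) 1 with hle | hgt
  · exact Or.inl (mem_convexHull_triple_iff_coord.2 ⟨β, γ, hβ0.le, hγ0.le, hle, e0, e1⟩)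
  · right
    have hs : 0 < β + γ := by linarith
    -- The ray from `a` through `x` meets the line `b c` where the two weights are rescaled to have
    -- sum 1.
    refine ⟨b + (γ / (β + γ)) • (c - b), ?_, ?_⟩
    · refine mem_openSegment_iff_coord.2 ⟨1 / (β + γ), by positivity, ?_, ?_, ?_⟩
      · rw [div_lt_one hs]; exact hgt
      · simp [e0]; field_simp; ring
      · simp [e1]; field_simp; ring
    · refine mem_openSegment_iff_coord.2 ⟨γ / (β + γ), by positivity, ?_, by simp, by simp⟩
      rw [div_lt_one hs]; linarith

/-- Points on the same ray from `a`. -/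
theorem eq_or_mem_openSegment_of_ray {a b c : Plane} {t : ℝ} (ht : 0 < t)
    (h0 : c 0 - a 0 = t * (b 0 - a 0)) (h1 : c 1 - a 1 = t * (b 1 - a 1)) :
    c = b ∨ c ∈ openSegment ℝ a b ∨ b ∈ openSegment ℝ a c := by
  rcases lt_trichotomy t 1 with h | h | h
  · exact Or.inr (Or.inl (mem_openSegment_iff_coord.2 ⟨t, ht, h, by linarith, by linarith⟩))
  · subst h
    exact Or.inl (Plane.ext (by linarith) (by linarith))
  · refine Or.inr (Or.inr (mem_openSegment_iff_coord.2
      ⟨t⁻¹, by positivity, inv_lt_one_of_one_lt₀ h, ?_, ?_⟩))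
    · rw [h0]; field_simp; ring
    · rw [h1]; field_simp; ring

/-- Two points in the same open half plane of a line through `a`, collinear with `a`, are on
the same ray. -/
theorem exists_ray_of_signedArea_eq_zero {a b c d : Plane} {σ : ℝ}
    (hb : 0 < σ * signedArea a d b) (hc : 0 < σ * signedArea a d c) (h : signedArea a b c = 0) :
    ∃ t : ℝ, 0 < t ∧ c 0 - a 0 = t * (b 0 - a 0) ∧ c 1 - a 1 = t * (b 1 - a 1) := by
  have hB : signedArea a d b ≠ 0 := by intro e; simp [e] at hb
  have hσ : σ ≠ 0 := by rintro rfl; simp at hb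
  refine ⟨signedArea a d c / signedArea a d b, ?_, ?_, ?_⟩
  · have : signedArea a d c / signedArea a d b
        = (σ * signedArea a d c) / (σ * signedArea a d b) := by field_simp
    rw [this]; positivity
  · field_simp
    unfold signedArea at *
    linear_combination (a 0 - d 0) * h
  · field_simp
    unfold signedArea at *
    linear_combination (a 1 - d 1) * h

/-! ### Noncrossing segments -/

/-- The segments `a b` and `c d` meet at most in common endpoints. -/
def MeetAtEnds (a b c d : Plane) : Prop :=
  ∀ x, x ∈ segment ℝ a b → x ∈ segment ℝ c d → (x = a ∨ x = b) ∧ (x = c ∨ x = d)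

theorem MeetAtEnds.symm {a b c d : Plane} (h : MeetAtEnds a b c d) : MeetAtEnds c d a b :=
  fun x hx hy => (h x hy hx).symm

theorem MeetAtEnds.swap {a b c d : Plane} (h : MeetAtEnds a b c d) : MeetAtEnds b a c d :=
  fun x hx hy => ⟨(h x (segment_symm ℝ b a ▸ hx) hy).1.symm, (h x (segment_symm ℝ b a ▸ hx) hy).2⟩

theorem MeetAtEnds.swap_right {a b c d : Plane} (h : MeetAtEnds a b c d) : MeetAtEnds a b d c :=
  h.symm.swap.symm

/-- A common point other than `o` puts `a` and `b` on one ray from `o`, where the nearer of two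
distinct points blocks the segment to the farther one. -/
theorem meetAtEnds_of_common {o a b : Plane} (hab : a ≠ b) (ha : a ∉ openSegment ℝ o b)
    (hb : b ∉ openSegment ℝ o a) : MeetAtEnds o a o b := by
  intro x hx hy
  obtain ⟨s, s0, s1, h0, h1⟩ := mem_segment_iff_coord.1 hx
  obtain ⟨t, t0, t1, g0, g1⟩ := mem_segment_iff_coord.1 hy
  by_cases hxo : x = o
  · exact ⟨Or.inl hxo, Or.inl hxo⟩
  exfalso
  have hs : 0 < s := by
    rcases s0.lt_or_eq with h | h
    · exact h
    · exact absurd (Plane.ext (by rw [h0, ← h]; ring) (by rw [h1, ← h]; ring)) hxo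
  have ht : 0 < t := by
    rcases t0.lt_or_eq with h | h
    · exact h
    · exact absurd (Plane.ext (by rw [g0, ← h]; ring) (by rw [g1, ← h]; ring)) hxo
  have e0 : a 0 - o 0 = (t / s) * (b 0 - o 0) := by field_simp; linarith
  have e1 : a 1 - o 1 = (t / s) * (b 1 - o 1) := by field_simp; linarith
  rcases eq_or_mem_openSegment_of_ray (by positivity) e0 e1 with h | h | h
  · exact hab h
  · exact ha h
  · exact hb h

/-- The one-dimensional case: the intervals with ends `0, 1` and `u, v` overlap in `s`, and neither
has an end inside the other, so they coincide. -/
theorem endpoints_eq_of_overlap {s t u v : ℝ} (hs0 : 0 < s) (hs1 : s < 1) (ht0 : 0 < t)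
    (ht1 : t < 1) (hst : s = u + t * (v - u)) (hu : ¬ (0 < u ∧ u < 1)) (hv : ¬ (0 < v ∧ v < 1))
    (h0 : ¬ 0 < (0 - u) * (v - 0)) (h1 : ¬ 0 < (1 - u) * (v - 1)) :
    (u = 0 ∧ v = 1) ∨ (u = 1 ∧ v = 0) := by
  rcases lt_trichotomy u v with h | h | h
  · left
    have us : u < s := by nlinarith
    have sv : s < v := by nlinarith
    have hu0 : u ≤ 0 := by by_contra k; exact hu ⟨by linarith, by linarith⟩
    have hv1 : 1 ≤ v := by by_contra k; exact hv ⟨by linarith, by linarith⟩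
    constructor
    · by_contra k
      have : u < 0 := lt_of_le_of_ne hu0 k
      exact h0 (mul_pos (by linarith) (by linarith))
    · by_contra k
      have : 1 < v := lt_of_le_of_ne hv1 (Ne.symm k)
      exact h1 (mul_pos (by linarith) (by linarith))
  · subst h
    have : s = u := by rw [hst]; ring
    exact absurd ⟨by linarith, by linarith⟩ hu
  · right
    have us : s < u := by nlinarith
    have sv : v < s := by nlinarith
    have hv0 : v ≤ 0 := by by_contra k; exact hv ⟨by linarith, by linarith⟩
    have hu1 : 1 ≤ u := by by_contra k; exact hu ⟨by linarith, by linarith⟩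
    constructor
    · by_contra k
      have : 1 < u := lt_of_le_of_ne hu1 (Ne.symm k)
      exact h1 (mul_pos_of_neg_of_neg (by linarith) (by linarith))
    · by_contra k
      have : v < 0 := lt_of_le_of_ne hv0 k
      exact h0 (mul_pos_of_neg_of_neg (by linarith) (by linarith))

/-- A segment on a supporting line of four points. -/
theorem meetAtEnds_of_support {a b c d : Plane} (hab : a ≠ b)
    (hne : ¬ ((a = c ∧ b = d) ∨ (a = d ∧ b = c)))
    (ha : a ∉ openSegment ℝ c d) (hb : b ∉ openSegment ℝ c d)
    (hc : c ∉ openSegment ℝ a b) (hd : d ∉ openSegment ℝ a b)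
    (hcs : 0 ≤ signedArea a b c) (hds : 0 ≤ signedArea a b d) : MeetAtEnds a b c d := by
  intro x hx hy
  obtain ⟨s, s0, s1, h0, h1⟩ := mem_segment_iff_coord.1 hx
  obtain ⟨t, t0, t1, g0, g1⟩ := mem_segment_iff_coord.1 hy
  have hend : ∀ z, z ∈ segment ℝ a b → z ∉ openSegment ℝ a b → z = a ∨ z = b := by
    intro z hz hz'
    by_contra hcon
    push Not at hcon
    exact hz' (mem_openSegment_of_ne_left_right hcon.1.symm hcon.2.symm hz)
  rcases t0.lt_or_eq with ht0 | ht0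
  swap
  · have : x = c := Plane.ext (by rw [g0, ← ht0]; ring) (by rw [g1, ← ht0]; ring)
    subst this
    exact ⟨hend x hx hc, Or.inl rfl⟩
  rcases t1.lt_or_eq with ht1 | ht1
  swap
  · have : x = d := Plane.ext (by rw [g0, ht1]; ring) (by rw [g1, ht1]; ring)
    subst this
    exact ⟨hend x hx hd, Or.inr rfl⟩
  exfalso
  have hxo : x ∈ openSegment ℝ c d := mem_openSegment_iff_coord.2 ⟨t, ht0, ht1, g0, g1⟩
  have hs0 : 0 < s := by
    rcases s0.lt_or_eq with h | h
    · exact h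
    · have : x = a := Plane.ext (by rw [h0, ← h]; ring) (by rw [h1, ← h]; ring)
      exact absurd (this ▸ hxo) ha
  have hs1 : s < 1 := by
    rcases s1.lt_or_eq with h | h
    · exact h
    · have : x = b := Plane.ext (by rw [h0, h]; ring) (by rw [h1, h]; ring)
      exact absurd (this ▸ hxo) hb
  -- `x` is on the line `a b` and strictly between `c` and `d`, which lie weakly on one side of it;
  -- hence both are on the line.
  have hz : (1 - t) * signedArea a b c + t * signedArea a b d = 0 := by
    have e : signedArea a b x = 0 := by unfold signedArea; rw [h0, h1]; ring
    rw [← e]; unfold signedArea; rw [g0, g1]; ring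
  have hc0 : signedArea a b c = 0 := by nlinarith [mul_nonneg ht0.le hds]
  have hd0 : signedArea a b d = 0 := by nlinarith [mul_nonneg (sub_pos.2 ht1).le hcs]
  -- the positions of `c` and `d` on the line `a b`
  have hN : 0 < (b 0 - a 0) ^ 2 + (b 1 - a 1) ^ 2 := normSq_sub_pos hab
  obtain ⟨u, c0, c1⟩ := exists_param_of_signedArea_eq_zero hab hc0
  obtain ⟨v, d0, d1⟩ := exists_param_of_signedArea_eq_zero hab hd0
  have hu : ¬ (0 < u ∧ u < 1) := fun h => hc (mem_openSegment_iff_coord.2 ⟨u, h.1, h.2, c0, c1⟩)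
  have hv : ¬ (0 < v ∧ v < 1) := fun h => hd (mem_openSegment_iff_coord.2 ⟨v, h.1, h.2, d0, d1⟩)
  have hst : s = u + t * (v - u) := by
    have k0 : (s - (u + t * (v - u))) * (b 0 - a 0) = 0 := by
      rw [g0, c0, d0] at h0; linear_combination -h0
    have k1 : (s - (u + t * (v - u))) * (b 1 - a 1) = 0 := by
      rw [g1, c1, d1] at h1; linear_combination -h1
    rcases mul_eq_zero.1 k0 with k | k
    · linarith
    rcases mul_eq_zero.1 k1 with k' | k'
    · linarith
    rw [k, k'] at hN; norm_num at hN
  -- A positive product expresses that `w` is strictly between `u` and `v` without fixing which of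
  -- them is larger.
  have hmem : ∀ w : ℝ, ∀ z : Plane, z 0 = a 0 + w * (b 0 - a 0) → z 1 = a 1 + w * (b 1 - a 1) →
      0 < (w - u) * (v - w) → z ∈ openSegment ℝ c d := by
    intro w z z0 z1 h
    have hvu : v - u ≠ 0 := by
      intro e
      have : (w - u) * (v - w) = -(w - u) ^ 2 := by linear_combination (w - u) * e
      have := sq_nonneg (w - u)
      linarith
    have hsq : 0 < (v - u) ^ 2 := by positivity
    refine mem_openSegment_iff_coord.2 ⟨(w - u) / (v - u), ?_, ?_, ?_, ?_⟩
    · rw [show (w - u) / (v - u) = ((w - u) * (v - u)) / (v - u) ^ 2 by field_simp]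
      refine div_pos ?_ hsq
      linear_combination h + sq_nonneg (w - u)
    · rw [show (w - u) / (v - u) = ((w - u) * (v - u)) / (v - u) ^ 2 by field_simp,
        div_lt_one hsq]
      linear_combination h + sq_nonneg (v - w)
    · rw [z0, c0, d0]; field_simp; ring
    · rw [z1, c1, d1]; field_simp; ring
  have hA : ¬ 0 < (0 - u) * (v - 0) := fun h => ha (hmem 0 a (by ring) (by ring) h)
  have hB : ¬ 0 < (1 - u) * (v - 1) := fun h => hb (hmem 1 b (by ring) (by ring) h)
  rcases endpoints_eq_of_overlap hs0 hs1 ht0 ht1 hst hu hv hA hB with ⟨rfl, rfl⟩ | ⟨rfl, rfl⟩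
  · exact hne (Or.inl ⟨Plane.ext (by linarith) (by linarith), Plane.ext (by linarith) (by linarith)⟩)
  · exact hne (Or.inr ⟨Plane.ext (by linarith) (by linarith), Plane.ext (by linarith) (by linarith)⟩)

/-! ### Triangulations given by their faces -/

/-- The clockwise faces of a triangulation of `P` in which every edge that is not on the hull is
incident to one of two points. -/
structure FaceSystem {P : Finset Plane} (F : P → P → P → Prop) : Prop where
  rotate : ∀ a b c, F a b c → F b c a
  clockwise : ∀ a b c : P, F a b c → Clockwise (a : Plane) b c
  no_interior : ∀ a b c : P, F a b c → ∀ x : P,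
    ¬ (Clockwise (a : Plane) b x ∧ Clockwise (b : Plane) c x ∧ Clockwise (c : Plane) a x)
  no_point : ∀ a b c : P, F a b c → ∀ x : P, (x : Plane) ∉ openSegment ℝ (a : Plane) b
  opposite : ∀ a b c : P, F a b c → (∃ d, F b a d) ∨ ∀ d : P, ¬ Clockwise (b : Plane) a d
  exists_face : ∀ a, ∃ b c, F a b c
  centres : ∃ p q : P,
    (∀ a b c, F a b c →
      (∀ d : P, ¬ Clockwise (b : Plane) a d) ∨ a = p ∨ b = p ∨ a = q ∨ b = q) ∧
    ∀ x y : P, p ≠ q → x ≠ q → y ≠ p → x ≠ y → (∃ c, F p x c ∨ F x p c) →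
      (∃ c, F q y c ∨ F y q c) → MeetAtEnds (p : Plane) x q y

namespace FaceSystem

variable {P : Finset Plane} {F : P → P → P → Prop}

theorem irrefl (hF : FaceSystem F) (a b : P) : ¬ F a a b := fun h => (hF.clockwise _ _ _ h).ne rfl

/-- The graph formed by the sides of the faces. -/
def graph (hF : FaceSystem F) : SimpleGraph P where
  Adj a b := ∃ c, F a b c ∨ F b a c
  symm := ⟨fun _ _ ⟨c, h⟩ => ⟨c, h.symm⟩⟩
  loopless := ⟨fun a ⟨b, h⟩ => hF.irrefl a b (h.elim id id)⟩

theorem no_point_of_adj (hF : FaceSystem F) {a b : P} (h : hF.graph.Adj a b) (x : P) :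
    (x : Plane) ∉ openSegment ℝ (a : Plane) b := by
  obtain ⟨c, h | h⟩ := h
  · exact hF.no_point _ _ _ h x
  · rw [openSegment_symm]
    exact hF.no_point _ _ _ h x

/-- All of `P` lies weakly on one side of such an edge, so another edge can touch its line only
along the line itself or at its own ends. -/
theorem meetAtEnds_of_hull_edge (hF : FaceSystem F) {a b c d : P} (h : hF.graph.Adj a b)
    (h' : hF.graph.Adj c d) (hne : s(a, b) ≠ s(c, d))
    (hs : (∀ x : P, ¬ Clockwise (a : Plane) b x) ∨ ∀ x : P, ¬ Clockwise (b : Plane) a x) :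
    MeetAtEnds (a : Plane) b c d := by
  have key : ∀ a b : P, hF.graph.Adj a b → s(a, b) ≠ s(c, d) →
      (∀ x : P, ¬ Clockwise (a : Plane) b x) → MeetAtEnds (a : Plane) b c d := by
    intro a b h hne hs
    refine meetAtEnds_of_support (fun e => h.ne (Subtype.ext e)) ?_ (hF.no_point_of_adj h' a)
      (hF.no_point_of_adj h' b) (hF.no_point_of_adj h c) (hF.no_point_of_adj h d)
      (not_lt.1 (hs c)) (not_lt.1 (hs d))
    rintro (⟨h1, h2⟩ | ⟨h1, h2⟩)
    · exact hne (by rw [Subtype.ext h1, Subtype.ext h2])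
    · exact hne (by rw [Subtype.ext h1, Subtype.ext h2, Sym2.eq_swap])
  rcases hs with hs | hs
  · exact key a b h hne hs
  · exact (key b a h.symm (by rwa [Sym2.eq_swap]) hs).swap

theorem meetAtEnds_of_common_end (hF : FaceSystem F) {o a b : P} (h : hF.graph.Adj o a)
    (h' : hF.graph.Adj o b) (hne : a ≠ b) : MeetAtEnds (o : Plane) a o b :=
  meetAtEnds_of_common (fun e => hne (Subtype.ext e)) (hF.no_point_of_adj h' a)
    (hF.no_point_of_adj h b)

theorem isNoncrossing (hF : FaceSystem F) : IsNoncrossing P hF.graph := by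
  refine ⟨fun a b p h => hF.no_point_of_adj h p, ?_⟩
  suffices H : ∀ a b c d : P, hF.graph.Adj a b → hF.graph.Adj c d → s(a, b) ≠ s(c, d) →
      MeetAtEnds (a : Plane) b c d from fun a b c d h h' hne x hx hy => H a b c d h h' hne x hx hy
  obtain ⟨p, q, hE, hX⟩ := hF.centres
  -- every edge is on the hull or starts, after a swap, at `p` or `q`
  have hC : ∀ a b, hF.graph.Adj a b →
      ((∀ x : P, ¬ Clockwise (a : Plane) b x) ∨ ∀ x : P, ¬ Clockwise (b : Plane) a x) ∨
      a = p ∨ b = p ∨ a = q ∨ b = q := by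
    rintro a b ⟨c, h | h⟩
    · rcases hE _ _ _ h with h | h
      · exact Or.inl (Or.inr h)
      · exact Or.inr h
    · rcases hE _ _ _ h with h | h
      · exact Or.inl (Or.inl h)
      · exact Or.inr (by tauto)
  have same : ∀ o x y, hF.graph.Adj o x → hF.graph.Adj o y → s(o, x) ≠ s(o, y) →
      MeetAtEnds (o : Plane) x o y := fun o x y hx hy hne =>
    hF.meetAtEnds_of_common_end hx hy (fun e => hne (by rw [e]))
  have diff : ∀ x y, hF.graph.Adj p x → hF.graph.Adj q y → s(p, x) ≠ s(q, y) →
      MeetAtEnds (p : Plane) x q y := by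
    intro x y hx hy hne
    by_cases hpq : p = q
    · subst hpq; exact same _ _ _ hx hy hne
    by_cases hxq : x = q
    · subst hxq
      exact (same _ _ _ hx.symm hy (by rwa [Sym2.eq_swap (a := x)])).swap
    by_cases hyp : y = p
    · subst hyp
      exact (same _ _ _ hx hy.symm (by rwa [Sym2.eq_swap (b := q)])).swap_right
    by_cases hxy : x = y
    · subst hxy
      exact (same _ _ _ hx.symm hy.symm
        (by rwa [Sym2.eq_swap (a := x), Sym2.eq_swap (b := q)])).swap.swap_right
    exact hX x y hpq hxq hyp hxy hx hy
  have fromP : ∀ x c d, hF.graph.Adj p x → hF.graph.Adj c d → s(p, x) ≠ s(c, d) →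
      MeetAtEnds (p : Plane) x c d := by
    intro x c d hx hcd hne
    rcases hC c d hcd with h | rfl | rfl | rfl | rfl
    · exact (hF.meetAtEnds_of_hull_edge hcd hx hne.symm h).symm
    · exact same _ _ _ hx hcd hne
    · exact (same _ _ _ hx hcd.symm (by rwa [Sym2.eq_swap (b := c)])).swap_right
    · exact diff _ _ hx hcd hne
    · exact (diff _ _ hx hcd.symm (by rwa [Sym2.eq_swap (b := c)])).swap_right
  have fromQ : ∀ x c d, hF.graph.Adj q x → hF.graph.Adj c d → s(q, x) ≠ s(c, d) →
      MeetAtEnds (q : Plane) x c d := by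
    intro x c d hx hcd hne
    rcases hC c d hcd with h | rfl | rfl | rfl | rfl
    · exact (hF.meetAtEnds_of_hull_edge hcd hx hne.symm h).symm
    · exact (diff _ _ hcd hx hne.symm).symm
    · exact ((diff _ _ hcd.symm hx (by rw [Sym2.eq_swap]; exact hne.symm)).symm).swap_right
    · exact same _ _ _ hx hcd hne
    · exact (same _ _ _ hx hcd.symm (by rwa [Sym2.eq_swap (b := c)])).swap_right
  intro a b c d hab hcd hne
  rcases hC a b hab with h | rfl | rfl | rfl | rfl
  · exact hF.meetAtEnds_of_hull_edge hab hcd hne h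
  · exact fromP _ _ _ hab hcd hne
  · exact (fromP _ _ _ hab.symm hcd (by rwa [Sym2.eq_swap (b := a)])).swap
  · exact fromQ _ _ _ hab hcd hne
  · exact (fromQ _ _ _ hab.symm hcd (by rwa [Sym2.eq_swap (b := a)])).swap

/-- A vanishing barycentric coordinate places `x` on a side, which `no_point` handles; three
positive coordinates make it an interior point, which `no_interior` forbids. -/
theorem is_face (hF : FaceSystem F) {a b c : P} (h : F a b c) {x : P}
    (hx : (x : Plane) ∈ convexHull ℝ {(a : Plane), (b : Plane), (c : Plane)}) :
    x = a ∨ x = b ∨ x = c := by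
  obtain ⟨β, γ, hβ, hγ, hs, e0, e1⟩ := mem_convexHull_triple_iff_coord.1 hx
  by_contra hne
  push Not at hne
  have hb := hF.rotate _ _ _ h
  have hc := hF.rotate _ _ _ hb
  have hD := hF.clockwise _ _ _ h
  have seg : ∀ u v w : P, F u v w → x ≠ u → x ≠ v → ∀ t : ℝ, 0 ≤ t → t ≤ 1 →
      (x : Plane) 0 = (u : Plane) 0 + t * ((v : Plane) 0 - (u : Plane) 0) →
      (x : Plane) 1 = (u : Plane) 1 + t * ((v : Plane) 1 - (u : Plane) 1) → False := by
    intro u v w huv hu hv t t0 t1 h0 h1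
    refine hF.no_point _ _ _ huv x (mem_openSegment_of_ne_left_right
      (fun e => hu (Subtype.ext e).symm) (fun e => hv (Subtype.ext e).symm)
      (mem_segment_iff_coord.2 ⟨t, t0, t1, h0, h1⟩))
  rcases hγ.lt_or_eq with hγ | hγ
  swap
  · subst hγ
    exact seg a b c h hne.1 hne.2.1 β hβ (by linarith) (by rw [e0]; ring) (by rw [e1]; ring)
  rcases hβ.lt_or_eq with hβ | hβ
  swap
  · subst hβ
    exact seg c a b hc hne.2.2 hne.1 (1 - γ) (by linarith) (by linarith) (by rw [e0]; ring)
      (by rw [e1]; ring)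
  rcases hs.lt_or_eq with hs | hs
  swap
  · obtain rfl : β = 1 - γ := by linarith
    exact seg b c a hb hne.2.1 hne.2.2 γ hγ.le (by linarith) (by rw [e0]; ring)
      (by rw [e1]; ring)
  refine hF.no_interior _ _ _ h x ⟨?_, ?_, ?_⟩ <;> rw [clockwise_iff] at *
  · have : signedArea (a : Plane) b x = γ * signedArea (a : Plane) b c := by
      unfold signedArea; rw [e0, e1]; ring
    rw [this]; exact mul_neg_of_pos_of_neg hγ hD
  · have : signedArea (b : Plane) c x = (1 - β - γ) * signedArea (a : Plane) b c := by
      unfold signedArea; rw [e0, e1]; ring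
    rw [this]; exact mul_neg_of_pos_of_neg (by linarith) hD
  · have : signedArea (c : Plane) a x = β * signedArea (a : Plane) b c := by
      unfold signedArea; rw [e0, e1]; ring
    rw [this]; exact mul_neg_of_pos_of_neg hβ hD

theorem isClockwiseTriangle (hF : FaceSystem F) {a b c : P} (h : F a b c) :
    IsClockwiseTriangle hF.graph a b c :=
  ⟨⟨c, Or.inl h⟩, ⟨a, Or.inl (hF.rotate _ _ _ h)⟩,
    ⟨b, Or.inl (hF.rotate _ _ _ (hF.rotate _ _ _ h))⟩, hF.clockwise _ _ _ h,
    fun _ hx => hF.is_face h hx⟩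

end FaceSystem

/-- A directed edge belongs to at most one clockwise triangle. -/
theorem IsClockwiseTriangle.unique {P : Finset Plane} {G : SimpleGraph P}
    (hG : IsNoncrossing P G) {a b c d : P} (hc : IsClockwiseTriangle G a b c)
    (hd : IsClockwiseTriangle G a b d) : c = d := by
  -- The direction of `d` from `a` cannot be strictly between those of `b` and `c`: otherwise `d` is
  -- inside the empty triangle `a b c`, or the edge `a d` crosses `b c`.
  have key : ∀ c d : P, IsClockwiseTriangle G a b c → IsClockwiseTriangle G a b d →
      ¬ signedArea (a : Plane) d c < 0 := by
    intro c d hc hd hlt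
    have h1 := clockwise_iff.1 hd.clockwise
    have h2 := clockwise_iff.1 hc.clockwise
    rcases mem_triangle_or_crosses (a := (a : Plane)) (b := b) (c := c) (x := d) (σ := -1) (by linarith) (by linarith) (by linarith) with
      h | ⟨y, hy, hy'⟩
    · rcases hc.is_face d h with rfl | rfl | rfl <;> simp at hlt h1
    · have hne : s(a, d) ≠ s(b, c) := by
        intro e
        rcases Sym2.eq_iff.1 e with ⟨rfl, rfl⟩ | ⟨rfl, rfl⟩ <;> simp at h1 h2
      have := (hG.no_cross a d b c hd.adj_ca.symm hc.adj_bc hne y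
        (openSegment_subset_segment _ _ _ hy) (openSegment_subset_segment _ _ _ hy')).1
      have had : (a : Plane) ≠ d := fun e => hd.adj_ca.ne (Subtype.ext e.symm)
      rcases this with rfl | rfl
      · exact had (left_mem_openSegment_iff.1 hy)
      · exact had (right_mem_openSegment_iff.1 hy)
  have hz : signedArea (a : Plane) c d = 0 := by
    have h1 := key c d hc hd
    have h2 := key d c hd hc
    rw [signedArea_swap_right] at h1
    linarith
  have h1 := clockwise_iff.1 hc.clockwise
  have h2 := clockwise_iff.1 hd.clockwise
  obtain ⟨t, ht, e0, e1⟩ := exists_ray_of_signedArea_eq_zero (σ := -1) (by linarith)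
    (by linarith) hz
  rcases eq_or_mem_openSegment_of_ray ht e0 e1 with h | h | h
  · exact (Subtype.ext h).symm
  · exact absurd h (hG.no_point _ _ _ hc.adj_ca.symm)
  · exact absurd h (hG.no_point _ _ _ hd.adj_ca.symm)

namespace FaceSystem

variable {P : Finset Plane} {F : P → P → P → Prop}

theorem isClockwiseTriangle_iff (hF : FaceSystem F) {a b c : P} :
    IsClockwiseTriangle hF.graph a b c ↔ F a b c := by
  refine ⟨fun h => ?_, hF.isClockwiseTriangle⟩
  -- The edge comes from a face on one of its sides. If that is the wrong side, there is a face
  -- opposite, since `c` shows that the edge is not on the hull.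
  have : ∃ d, F a b d := by
    obtain ⟨d, hd | hd⟩ := h.adj_ab
    · exact ⟨d, hd⟩
    · exact (hF.opposite _ _ _ hd).resolve_right (fun h' => h' c h.clockwise)
  obtain ⟨d, hd⟩ := this
  rwa [h.unique hF.isNoncrossing (hF.isClockwiseTriangle hd)]

/-- On each side of an edge on which there are points there is a face. -/
theorem exists_face_of_side (hF : FaceSystem F) {a c : P} (h : hF.graph.Adj a c) {b : P} {σ : ℝ}
    (hσ : σ = 1 ∨ σ = -1) (hb : 0 < σ * signedArea (a : Plane) c b) :
    ∃ d : P, 0 < σ * signedArea (a : Plane) c d ∧ hF.graph.Adj a d ∧ hF.graph.Adj c d ∧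
      ∀ x : P, (x : Plane) ∈ convexHull ℝ {(a : Plane), (c : Plane), (d : Plane)} →
        x = a ∨ x = c ∨ x = d := by
  rcases hσ with rfl | rfl
  · have hcw : Clockwise (c : Plane) a b := by
      rw [clockwise_iff, signedArea_swap]; linarith
    have : ∃ d, F c a d := by
      obtain ⟨d, hd | hd⟩ := h
      · exact (hF.opposite _ _ _ hd).resolve_right (fun h' => h' b hcw)
      · exact ⟨d, hd⟩
    obtain ⟨d, hd⟩ := this
    have ht := hF.isClockwiseTriangle hd
    refine ⟨d, ?_, ht.adj_bc, ht.adj_ca.symm, fun x hx => ?_⟩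
    · have := clockwise_iff.1 ht.clockwise
      rw [signedArea_swap] at this; linarith
    · rw [Set.insert_comm] at hx
      have := ht.is_face x hx; tauto
  · have hcw : Clockwise (a : Plane) c b := by
      rw [clockwise_iff]; linarith
    have : ∃ d, F a c d := by
      obtain ⟨d, hd | hd⟩ := h
      · exact ⟨d, hd⟩
      · exact (hF.opposite _ _ _ hd).resolve_right (fun h' => h' b hcw)
    obtain ⟨d, hd⟩ := this
    have ht := hF.isClockwiseTriangle hd
    refine ⟨d, ?_, ht.adj_ca.symm, ht.adj_bc, ht.is_face⟩
    have := clockwise_iff.1 ht.clockwise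
    linarith

/-- For a new segment `a b`, the idea is to find the face at `a` whose angle contains the direction
of `b`. The function `f` is the cotangent of the angle between `a c` and `a b`, so its maximum picks
the neighbour closest in direction on one side; the face beyond that neighbour is then entered by `a
b`. -/
theorem isTriangulation (hF : FaceSystem F) : IsTriangulation P hF.graph := by
  refine ⟨hF.isNoncrossing, fun T hT hle a b hab => ?_⟩
  by_contra hnab
  have habne : (a : Plane) ≠ b := fun e => hab.ne (Subtype.ext e)
  -- a neighbour of `a` off the line `a b`
  have hex : ∃ c, hF.graph.Adj a c ∧ signedArea (a : Plane) c b ≠ 0 := by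
    obtain ⟨c, d, hcd⟩ := hF.exists_face a
    have ht := hF.isClockwiseTriangle hcd
    by_contra hcon
    push Not at hcon
    have h1 := hcon c ht.adj_ab
    have h2 := hcon d ht.adj_ca.symm
    have hD := (clockwise_iff.1 ht.clockwise).ne
    apply habne
    unfold signedArea at *
    refine Plane.ext ?_ ?_ <;> rw [← sub_eq_zero] <;> apply (mul_eq_zero.1 _).resolve_left hD
    · linear_combination ((c : Plane) 0 - (a : Plane) 0) * h2 - ((d : Plane) 0 - (a : Plane) 0) * h1
    · linear_combination ((c : Plane) 1 - (a : Plane) 1) * h2 - ((d : Plane) 1 - (a : Plane) 1) * h1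
  obtain ⟨σ, hσ, c₀, hc₀, hs₀⟩ : ∃ σ : ℝ, (σ = 1 ∨ σ = -1) ∧
      ∃ c, hF.graph.Adj a c ∧ 0 < σ * signedArea (a : Plane) c b := by
    obtain ⟨c, hc, hne⟩ := hex
    rcases hne.lt_or_gt with h | h
    · exact ⟨-1, Or.inr rfl, c, hc, by linarith⟩
    · exact ⟨1, Or.inl rfl, c, hc, by linarith⟩
  -- among the neighbours on that side, one closest to the direction of `b`
  let f : P → ℝ := fun c => (((c : Plane) 0 - (a : Plane) 0) * ((b : Plane) 0 - (a : Plane) 0) +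
    ((c : Plane) 1 - (a : Plane) 1) * ((b : Plane) 1 - (a : Plane) 1)) /
      (σ * signedArea (a : Plane) c b)
  obtain ⟨c, ⟨hac, hcb⟩, hmax⟩ := Set.exists_max_image
    {c : P | hF.graph.Adj a c ∧ 0 < σ * signedArea (a : Plane) c b} f (Set.toFinite _)
    ⟨c₀, hc₀, hs₀⟩
  obtain ⟨d, hd, had, hcd, hface⟩ := hF.exists_face_of_side hac hσ hcb
  have hσ2 : σ * σ = 1 := by rcases hσ with rfl | rfl <;> norm_num
  -- The direction of `b` is strictly inside the angle at `a` of the face `a c d`, or along `a d`,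
  -- or beyond `d`; in the last case `d` would be closer than `c`.
  rcases lt_trichotomy (σ * signedArea (a : Plane) d b) 0 with h | h | h
  · rcases mem_triangle_or_crosses (a := (a : Plane)) (b := c) (c := d) (x := b) hcb
      (by rw [signedArea_swap_right]; linarith) hd with h' | ⟨y, hy, hy'⟩
    · rcases hface b h' with rfl | rfl | rfl
      · exact habne rfl
      · exact hnab hac
      · exact hnab had
    · have hne : s(a, b) ≠ s(c, d) := by
        intro e
        rcases Sym2.eq_iff.1 e with ⟨rfl, rfl⟩ | ⟨rfl, rfl⟩ <;> simp at hd
      rcases (hT.no_cross a b c d hab (hle hcd) hne y (openSegment_subset_segment _ _ _ hy)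
        (openSegment_subset_segment _ _ _ hy')).1 with rfl | rfl
      · exact habne (left_mem_openSegment_iff.1 hy)
      · exact habne (right_mem_openSegment_iff.1 hy)
  · have hz : signedArea (a : Plane) d b = 0 := by
      rcases hσ with rfl | rfl <;> linarith
    obtain ⟨t, ht, e0, e1⟩ := exists_ray_of_signedArea_eq_zero hd hcb hz
    rcases eq_or_mem_openSegment_of_ray ht e0 e1 with h | h | h
    · exact hnab (by rwa [Subtype.ext h])
    · exact hF.no_point_of_adj had b h
    · exact hT.no_point _ _ _ hab h
  · have := hmax d ⟨had, h⟩
    simp only [f] at this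
    rw [div_le_div_iff₀ h hcb] at this
    -- After clearing denominators, the difference of the cotangents of `d` and `c` is the squared
    -- length of `a b` times `σ * signedArea a c d`, which is positive.
    have hN := normSq_sub_pos habne
    have := mul_pos hd hN
    unfold signedArea at *
    linarith

/-- The triangulation with given faces. -/
theorem exists_isTriangulation (hF : FaceSystem F) :
    ∃ S : SimpleGraph P, IsTriangulation P S ∧ ∀ a b c, IsClockwiseTriangle S a b c ↔ F a b c :=
  ⟨hF.graph, hF.isTriangulation, fun _ _ _ => hF.isClockwiseTriangle_iff⟩

end FaceSystem

/-! ### Compatible triangulations from labelled faces -/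

/-- The faces whose vertices have the labels of a face. -/
def faceImage {L : Type} {P : Finset Plane} (e : L → P) (F : L → L → L → Prop) (x y z : P) : Prop :=
  ∃ a b c, F a b c ∧ e a = x ∧ e b = y ∧ e c = z

/-- Labels may repeat, as natural numbers are used for indices modulo the number of hull points.
Equal kernels are what makes `e a ↦ e' a` a well-defined bijection of the point sets. -/
theorem haveCompatibleTriangulations_of_labels {L : Type} {P Q : Finset Plane} {e : L → P}
    {e' : L → Q} (he : Function.Surjective e) (he' : Function.Surjective e')
    (hker : ∀ a b, e a = e b ↔ e' a = e' b) {F : L → L → L → Prop}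
    (hP : FaceSystem (faceImage e F)) (hQ : FaceSystem (faceImage e' F)) :
    HaveCompatibleTriangulations P Q := by
  obtain ⟨S, hS, hSF⟩ := hP.exists_isTriangulation
  obtain ⟨T, hT, hTF⟩ := hQ.exists_isTriangulation
  let φ : P → Q := fun x => e' (Function.surjInv he x)
  have hφ : ∀ a, φ (e a) = e' a := fun a =>
    (hker _ _).1 (Function.surjInv_eq he (e a))
  have hinj : Function.Injective φ := by
    intro x y hxy
    obtain ⟨a, rfl⟩ := he x
    obtain ⟨b, rfl⟩ := he y
    rw [hφ, hφ] at hxy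
    exact (hker _ _).2 hxy
  have hsurj : Function.Surjective φ := by
    intro y
    obtain ⟨a, rfl⟩ := he' y
    exact ⟨e a, hφ a⟩
  refine ⟨S, T, hS, hT, Equiv.ofBijective φ ⟨hinj, hsurj⟩, fun x y z => ?_⟩
  rw [hSF, hTF]
  change faceImage e F x y z ↔ faceImage e' F (φ x) (φ y) (φ z)
  constructor
  · rintro ⟨a, b, c, h, rfl, rfl, rfl⟩
    exact ⟨a, b, c, h, (hφ a).symm, (hφ b).symm, (hφ c).symm⟩
  · rintro ⟨a, b, c, h, h1, h2, h3⟩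
    exact ⟨a, b, c, h, hinj (by rw [hφ, h1]), hinj (by rw [hφ, h2]), hinj (by rw [hφ, h3])⟩

/-! ### The interior of the convex hull -/

section Interior

variable {P : Finset Plane}

/-- The strict inequalities cut out an open set, and barycentric coordinates show that it is inside
the triangle. In the face systems this rules out hull points inside a face. -/
theorem mem_interior_of_clockwise {a b c x : Plane} (ha : a ∈ P) (hb : b ∈ P) (hc : c ∈ P)
    (h1 : Clockwise a b x) (h2 : Clockwise b c x) (h3 : Clockwise c a x) :
    x ∈ interior (convexHull ℝ (P : Set Plane)) := by
  have hopen : IsOpen {y : Plane | Clockwise a b y ∧ Clockwise b c y ∧ Clockwise c a y} := by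
    have hcont : ∀ u v : Plane, Continuous (signedArea u v) := by
      intro u v
      unfold signedArea
      fun_prop
    exact (isOpen_lt (hcont a b) continuous_const).inter
      ((isOpen_lt (hcont b c) continuous_const).inter (isOpen_lt (hcont c a) continuous_const))
  refine mem_interior.2 ⟨_, ?_, hopen, ⟨h1, h2, h3⟩⟩
  rintro y ⟨h1, h2, h3⟩
  rw [clockwise_iff] at h1 h2 h3
  have hsub : convexHull ℝ {a, b, c} ⊆ convexHull ℝ (P : Set Plane) := by
    refine convexHull_mono ?_
    rintro z (rfl | rfl | rfl) <;> simpa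
  apply hsub
  have hD : signedArea a b c = signedArea a b y + signedArea b c y + signedArea c a y := by
    unfold signedArea; ring
  have hD0 : signedArea a b c < 0 := by linarith
  refine mem_convexHull_triple_iff_coord.2 ⟨signedArea c a y / signedArea a b c,
    signedArea a b y / signedArea a b c, (div_pos_of_neg_of_neg h3 hD0).le,
    (div_pos_of_neg_of_neg h1 hD0).le, ?_, ?_, ?_⟩
  · rw [← add_div, div_le_one_of_neg hD0]; linarith
  · have := hD0.ne
    field_simp; unfold signedArea; ring
  · have := hD0.ne
    field_simp; unfold signedArea; ring

/-- A nonconstant affine function on the hull has no maximum at an interior point, and a bound on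
`P` extends to the hull by convexity. -/
theorem exists_lt_signedArea {x : Plane} (hx : x ∈ interior (convexHull ℝ (P : Set Plane)))
    {u v : Plane} (huv : u ≠ v) : ∃ y ∈ P, signedArea u v x < signedArea u v y := by
  by_contra hcon
  push Not at hcon
  have hN : 0 < (v 0 - u 0) ^ 2 + (v 1 - u 1) ^ 2 := normSq_sub_pos huv
  have hle : ∀ y ∈ convexHull ℝ (P : Set Plane), signedArea u v y ≤ signedArea u v x := by
    intro y hy
    have hcv : Convex ℝ {y : Plane | signedArea u v y ≤ signedArea u v x} := by
      intro a ha b hb s t hs ht hst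
      simp only [Set.mem_ofPred_eq] at *
      have : signedArea u v (s • a + t • b) = s * signedArea u v a + t * signedArea u v b := by
        obtain rfl : s = 1 - t := by linarith
        simp [signedArea]; ring
      rw [this]
      obtain rfl : s = 1 - t := by linarith
      nlinarith
    exact convexHull_min (fun z hz => hcon z hz) hcv hy
  -- A quarter turn of `v - u`, the gradient of `signedArea u v`.
  let n : Plane := !₂[-(v 1 - u 1), v 0 - u 0]
  have hcont : Filter.Tendsto (fun ε : ℝ => x + ε • n) (nhdsWithin 0 (Set.Ioi 0)) (nhds x) := by
    have : Continuous (fun ε : ℝ => x + ε • n) := by fun_prop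
    have h := (this.tendsto 0).mono_left (nhdsWithin_le_nhds (s := Set.Ioi 0))
    simpa using h
  obtain ⟨ε, hε, hε0⟩ := ((hcont.eventually (isOpen_interior.mem_nhds hx)).and
    self_mem_nhdsWithin).exists
  have h1 := hle _ (interior_subset hε)
  have h2 : signedArea u v (x + ε • n) =
      signedArea u v x + ε * ((v 0 - u 0) ^ 2 + (v 1 - u 1) ^ 2) := by
    simp [signedArea, n]; ring
  rw [h2] at h1
  have : 0 < ε * ((v 0 - u 0) ^ 2 + (v 1 - u 1) ^ 2) := mul_pos hε0 hN
  linarith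

theorem mem_hullPoints_iff {x : Plane} :
    x ∈ hullPoints P ↔ x ∈ P ∧ x ∉ interior (convexHull ℝ (P : Set Plane)) := by
  unfold hullPoints
  simp only [Set.mem_ofPred_eq]
  refine and_congr_right fun hx => ?_
  have hcl : x ∈ closure (convexHull ℝ (P : Set Plane)) :=
    subset_closure (subset_convexHull ℝ _ hx)
  rw [frontier, Set.mem_sdiff]
  exact and_iff_right hcl

theorem mem_hullPoints_or_mem_internalPoints {x : Plane} (hx : x ∈ P) :
    x ∈ hullPoints P ∨ x ∈ internalPoints P := by
  by_cases h : x ∈ interior (convexHull ℝ (P : Set Plane))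
  · exact Or.inr ⟨hx, h⟩
  · exact Or.inl (mem_hullPoints_iff.2 ⟨hx, h⟩)

theorem disjoint_hullPoints_internalPoints : Disjoint (hullPoints P) (internalPoints P) :=
  Set.disjoint_left.2 fun _ hx hy => (mem_hullPoints_iff.1 hx).2 hy.2

theorem hullPoints_union_internalPoints : hullPoints P ∪ internalPoints P = P := by
  ext x
  constructor
  · rintro (h | h) <;> exact h.1
  · exact fun h => mem_hullPoints_or_mem_internalPoints h

theorem ncard_hullPoints_add_ncard_internalPoints :
    (hullPoints P).ncard + (internalPoints P).ncard = P.card := by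
  rw [← Set.ncard_union_eq disjoint_hullPoints_internalPoints
    (P.finite_toSet.subset fun _ h => h.1) (P.finite_toSet.subset fun _ h => h.1),
    hullPoints_union_internalPoints, Set.ncard_coe_finset]

theorem exists_hullPoint_max (hP : P.Nonempty) {u v : Plane} (huv : u ≠ v) :
    ∃ y ∈ hullPoints P, ∀ x ∈ P, signedArea u v x ≤ signedArea u v y := by
  obtain ⟨y, hy, hmax⟩ := P.exists_max_image (signedArea u v) hP
  refine ⟨y, mem_hullPoints_iff.2 ⟨hy, fun hint => ?_⟩, hmax⟩
  obtain ⟨z, hz, hlt⟩ := exists_lt_signedArea hint huv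
  exact absurd (hmax z hz) (not_le.2 hlt)

theorem mem_interior_of_mem_openSegment {o x y : Plane}
    (ho : o ∈ interior (convexHull ℝ (P : Set Plane))) (hx : x ∈ P)
    (hy : y ∈ openSegment ℝ o x) : y ∈ interior (convexHull ℝ (P : Set Plane)) :=
  (convex_convexHull ℝ _).openSegment_interior_self_subset_interior ho
    (subset_convexHull ℝ _ hx) hy

/-- A point of the triangle with the interior point `o` as a vertex is in the interior, unless
it is on the opposite side. -/
theorem mem_interior_of_combo {o a b y : Plane}
    (ho : o ∈ interior (convexHull ℝ (P : Set Plane))) (ha : a ∈ P) (hb : b ∈ P)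
    {β γ : ℝ} (hβ : 0 ≤ β) (hγ : 0 ≤ γ) (h : β + γ < 1)
    (h0 : y 0 = o 0 + β * (a 0 - o 0) + γ * (b 0 - o 0))
    (h1 : y 1 = o 1 + β * (a 1 - o 1) + γ * (b 1 - o 1)) :
    y ∈ interior (convexHull ℝ (P : Set Plane)) := by
  have hc := convex_convexHull ℝ (P : Set Plane)
  rcases (add_nonneg hβ hγ).lt_or_eq with hs | hs
  -- The ray from `o` through `y` meets the segment `a b` in `z`, and `y` is strictly before it.
  · let z : Plane := (β / (β + γ)) • a + (γ / (β + γ)) • b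
    have hz : z ∈ convexHull ℝ (P : Set Plane) :=
      hc (subset_convexHull ℝ _ ha) (subset_convexHull ℝ _ hb) (by positivity) (by positivity)
        (by field_simp)
    refine hc.openSegment_interior_self_subset_interior ho hz
      (mem_openSegment_iff_coord.2 ⟨β + γ, hs, h, ?_, ?_⟩)
    · rw [h0]; simp [z]; field_simp; ring
    · rw [h1]; simp [z]; field_simp; ring
  · have hβ' : β = 0 := by linarith
    have hγ' : γ = 0 := by linarith
    subst hβ' hγ'
    have : y = o := Plane.ext (by rw [h0]; ring) (by rw [h1]; ring)
    rwa [this]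

end Interior

/-! ### Directions seen from a point -/

/-- `x` is on the open ray from `o` in the direction `α`. -/
def OnRay (o : Plane) (α : ℝ) (x : Plane) : Prop :=
  ∃ r : ℝ, 0 < r ∧ x 0 = o 0 + r * Real.cos α ∧ x 1 = o 1 + r * Real.sin α

theorem sin_pos_imp_lt_pi {δ : ℝ} (h : δ ≤ 2 * Real.pi) (hs : 0 < Real.sin δ) : δ < Real.pi := by
  by_contra hcon
  have : 0 ≤ Real.sin (δ - Real.pi) :=
    Real.sin_nonneg_of_nonneg_of_le_pi (by linarith) (by linarith)
  rw [Real.sin_sub_pi] at this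
  linarith

theorem sin_neg_imp_pi_lt {δ : ℝ} (h : 0 ≤ δ) (hs : Real.sin δ < 0) : Real.pi < δ := by
  by_contra hcon
  have : 0 ≤ Real.sin δ := Real.sin_nonneg_of_nonneg_of_le_pi h (by linarith)
  linarith

namespace OnRay

variable {o x y : Plane} {α β : ℝ}

theorem exists_of_ne (h : x ≠ o) : ∃ α, OnRay o α x := by
  let z : ℂ := ⟨x 0 - o 0, x 1 - o 1⟩
  have hz : z ≠ 0 := by
    intro e
    have e0 := congrArg Complex.re e
    have e1 := congrArg Complex.im e
    simp only [z, Complex.zero_re, Complex.zero_im] at e0 e1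
    exact h (Plane.ext (by linarith) (by linarith))
  refine ⟨z.arg, ‖z‖, norm_pos_iff.2 hz, ?_, ?_⟩
  · rw [Complex.norm_mul_cos_arg]; simp [z]
  · rw [Complex.norm_mul_sin_arg]; simp [z]

theorem add_int_mul (h : OnRay o α x) (k : ℤ) : OnRay o (α + k * (2 * Real.pi)) x := by
  obtain ⟨r, hr, h0, h1⟩ := h
  exact ⟨r, hr, by rw [Real.cos_add_int_mul_two_pi, h0], by rw [Real.sin_add_int_mul_two_pi, h1]⟩

theorem exists_signedArea_eq (hx : OnRay o α x) (hy : OnRay o β y) :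
    ∃ r : ℝ, 0 < r ∧ signedArea o x y = r * Real.sin (β - α) := by
  obtain ⟨r, hr, h0, h1⟩ := hx
  obtain ⟨s, hs, g0, g1⟩ := hy
  refine ⟨r * s, mul_pos hr hs, ?_⟩
  unfold signedArea
  rw [h0, h1, g0, g1, Real.sin_sub]; ring

theorem signedArea_pos_iff (hx : OnRay o α x) (hy : OnRay o β y) :
    0 < signedArea o x y ↔ 0 < Real.sin (β - α) := by
  obtain ⟨r, hr, h⟩ := hx.exists_signedArea_eq hy
  rw [h, mul_pos_iff_of_pos_left hr]

theorem signedArea_neg_iff (hx : OnRay o α x) (hy : OnRay o β y) :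
    signedArea o x y < 0 ↔ Real.sin (β - α) < 0 := by
  obtain ⟨r, hr, h⟩ := hx.exists_signedArea_eq hy
  rw [h]
  constructor
  · intro h; by_contra hc; have := mul_nonneg hr.le (not_lt.1 hc); linarith
  · exact mul_neg_of_pos_of_neg hr

/-- A direction outside the cone spanned by two directions. -/
theorem not_mem_cone {a b : Plane} {γ : ℝ} (ha : OnRay o α a) (hb : OnRay o β b)
    (hx : OnRay o γ x) (hab : α ≤ β) (hπ : β < α + Real.pi) (h1 : β < γ)
    (h2 : γ < α + 2 * Real.pi) {s l m : ℝ} (hs : 0 ≤ s) (hl : 0 ≤ l) (hm : 0 ≤ m)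
    (hlm : 0 < l + m) (e0 : s * (x 0 - o 0) = l * (a 0 - o 0) + m * (b 0 - o 0))
    (e1 : s * (x 1 - o 1) = l * (a 1 - o 1) + m * (b 1 - o 1)) : False := by
  obtain ⟨r, hr, x0, x1⟩ := hx
  obtain ⟨p, hp, a0, a1⟩ := ha
  obtain ⟨q, hq, b0, b1⟩ := hb
  rw [x0, a0, b0] at e0
  rw [x1, a1, b1] at e1
  -- Cross products of the vector equation with the directions `α` and `β`. In the nondegenerate
  -- case their signs force `γ - α ≤ π ≤ γ - β`, which contradicts `α < β`.
  have cα : s * r * Real.sin (γ - α) = m * q * Real.sin (β - α) := by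
    rw [Real.sin_sub, Real.sin_sub]
    linear_combination Real.cos α * e1 - Real.sin α * e0
  have cβ : s * r * Real.sin (γ - β) = - (l * p * Real.sin (β - α)) := by
    rw [Real.sin_sub, Real.sin_sub]
    linear_combination Real.cos β * e1 - Real.sin β * e0
  have dα : s * r * Real.cos (γ - α) = l * p + m * q * Real.cos (β - α) := by
    rw [Real.cos_sub, Real.cos_sub]
    linear_combination Real.cos α * e0 + Real.sin α * e1 +
      l * p * (Real.sin_sq_add_cos_sq α)
  rcases hab.lt_or_eq with hlt | rfl
  · have hsin : 0 < Real.sin (β - α) := Real.sin_pos_of_pos_of_lt_pi (by linarith) (by linarith)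
    have hs' : 0 < s := by
      rcases hs.lt_or_eq with h | rfl
      · exact h
      · have z1 : m = 0 := by
          have : m * (q * Real.sin (β - α)) = 0 := by linear_combination -cα
          exact (mul_eq_zero.1 this).resolve_right (by positivity)
        have z2 : l = 0 := by
          have : l * (p * Real.sin (β - α)) = 0 := by linear_combination cβ
          exact (mul_eq_zero.1 this).resolve_right (by positivity)
        linarith
    have hsr : 0 < s * r := mul_pos hs' hr
    have k1 : 0 ≤ Real.sin (γ - α) := by
      by_contra hc
      have := mul_neg_of_pos_of_neg hsr (not_le.1 hc)
      have : 0 ≤ m * q * Real.sin (β - α) := by positivity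
      linarith
    have k2 : Real.sin (γ - β) ≤ 0 := by
      by_contra hc
      have := mul_pos hsr (not_le.1 hc)
      have : 0 ≤ l * p * Real.sin (β - α) := by positivity
      linarith
    have g1 : γ - α ≤ Real.pi := by
      by_contra hc
      have : 0 < Real.sin (γ - α - Real.pi) :=
        Real.sin_pos_of_pos_of_lt_pi (by linarith) (by linarith)
      rw [Real.sin_sub_pi] at this; linarith
    have g2 : Real.pi ≤ γ - β := by
      by_contra hc
      have : 0 < Real.sin (γ - β) := Real.sin_pos_of_pos_of_lt_pi (by linarith) (by linarith)
      linarith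
    linarith
  -- The cone is a single ray: the vanishing sine leaves only the opposite direction, where the
  -- cosine has the wrong sign.
  · simp only [sub_self, Real.sin_zero, mul_zero, Real.cos_zero, mul_one] at cα dα
    have hpos : 0 < l * p + m * q := by
      rcases hl.lt_or_eq with h | rfl
      · positivity
      · have : 0 < m := by linarith
        positivity
    have hsr : 0 < s * r := by
      rcases (mul_nonneg hs hr.le).lt_or_eq with h | h
      · exact h
      · rw [← h] at dα; linarith
    have k1 : Real.sin (γ - α) = 0 := (mul_eq_zero.1 cα).resolve_left hsr.ne'
    have k2 : 0 < Real.cos (γ - α) := by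
      by_contra hc
      have := mul_nonpos_of_nonneg_of_nonpos hsr.le (not_lt.1 hc)
      linarith
    have hπ' : γ - α = Real.pi := by
      rcases lt_trichotomy (γ - α) Real.pi with h | h | h
      · have := Real.sin_pos_of_pos_of_lt_pi (x := γ - α) (by linarith) h
        linarith
      · exact h
      · have : 0 < Real.sin (γ - α - Real.pi) :=
          Real.sin_pos_of_pos_of_lt_pi (by linarith) (by linarith)
        rw [Real.sin_sub_pi] at this; linarith
    rw [hπ', Real.cos_pi] at k2
    linarith

end OnRay

/-! ### The cyclic order of the hull points -/

/-- The hull points of `P` in counterclockwise order `h`, repeated with period `m`, with their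
directions `θ` seen from a point `o` in the interior of the hull. -/
structure HullCycle (P : Finset Plane) (o : Plane) (m : ℕ) (h : ℕ → Plane) (θ : ℕ → ℝ) :
    Prop where
  interior : o ∈ interior (convexHull ℝ (P : Set Plane))
  pos : 0 < m
  mono : StrictMono θ
  theta_add : ∀ i, θ (i + m) = θ i + 2 * Real.pi
  periodic : Function.Periodic h m
  ray : ∀ i, OnRay o (θ i) (h i)
  mem_iff : ∀ x, x ∈ hullPoints P ↔ ∃ i, h i = x

/-- Sort the arguments of the hull points seen from `o`, and add a full turn at each pass through
the list. Different hull points have different directions, because the nearer of two on a ray would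
be on an open segment from an interior point to a point of `P`, hence interior. -/
theorem exists_hullCycle {P : Finset Plane} {o : Plane}
    (ho : o ∈ interior (convexHull ℝ (P : Set Plane))) : ∃ m h θ, HullCycle P o m h θ := by
  classical
  have hP : P.Nonempty := by
    by_contra hcon
    rw [Finset.not_nonempty_iff_eq_empty] at hcon
    subst hcon
    simp at ho
  -- the argument of `x - o`
  let α : Plane → ℝ := fun x => Complex.arg ⟨x 0 - o 0, x 1 - o 1⟩
  let H : Finset Plane := P.filter (fun x => x ∉ interior (convexHull ℝ (P : Set Plane)))
  have hH : ∀ x, x ∈ H ↔ x ∈ hullPoints P := fun x => by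
    rw [mem_hullPoints_iff]; exact Finset.mem_filter
  have hray : ∀ x ∈ H, OnRay o (α x) x := by
    intro x hx
    have hne : (⟨x 0 - o 0, x 1 - o 1⟩ : ℂ) ≠ 0 := by
      intro e
      have e0 := congrArg Complex.re e
      have e1 := congrArg Complex.im e
      simp only [Complex.zero_re, Complex.zero_im] at e0 e1
      have : x = o := Plane.ext (by linarith) (by linarith)
      exact (mem_hullPoints_iff.1 ((hH x).1 hx)).2 (this ▸ ho)
    refine ⟨‖(⟨x 0 - o 0, x 1 - o 1⟩ : ℂ)‖, norm_pos_iff.2 hne, ?_, ?_⟩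
    · simp only [α]; rw [Complex.norm_mul_cos_arg]; ring
    · simp only [α]; rw [Complex.norm_mul_sin_arg]; ring
  let A : Finset ℝ := H.image α
  obtain ⟨y₀, hy₀, -⟩ := exists_hullPoint_max hP
    (u := (!₂[0, 0] : Plane)) (v := !₂[1, 0]) (fun e => by simpa using congrFun (congrArg WithLp.ofLp e) 0)
  have hm : 0 < A.card := Finset.card_pos.2 ⟨_, Finset.mem_image_of_mem α ((hH _).2 hy₀)⟩
  let s : Fin A.card ↪o ℝ := A.orderEmbOfFin rfl
  have hs : ∀ i, ∃ x ∈ H, α x = s i := fun i =>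
    Finset.mem_image.1 (A.orderEmbOfFin_mem rfl i)
  choose g hgH hgα using hs
  -- Arguments lie in `(-π, π]`, so the first direction of the next turn comes after the last one of
  -- this turn.
  have hsub : ∀ i j, s i < s j + 2 * Real.pi := by
    intro i j
    rw [← hgα, ← hgα]
    have h1 := Complex.arg_le_pi ⟨g i 0 - o 0, g i 1 - o 1⟩
    have h2 := Complex.neg_pi_lt_arg ⟨g j 0 - o 0, g j 1 - o 1⟩
    simp only [α]
    linarith
  let r : ℕ → Fin A.card := fun i => ⟨i % A.card, Nat.mod_lt _ hm⟩
  refine ⟨A.card, fun i => g (r i),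
    fun i => s (r i) + ((i / A.card : ℕ) : ℤ) * (2 * Real.pi), ho, hm, ?_, ?_, ?_, ?_, ?_⟩
  · refine strictMono_nat_of_lt_succ fun i => ?_
    have hi := Nat.mod_lt i hm
    have hdiv := Nat.div_add_mod i A.card
    rcases Nat.lt_or_ge (i % A.card + 1) A.card with hlt | hge
    · have e1 : (i + 1) % A.card = i % A.card + 1 := by
        rw [← hdiv, add_assoc, Nat.mul_add_mod, Nat.mod_eq_of_lt hlt, Nat.mul_add_mod, Nat.mod_mod]
      have e2 : (i + 1) / A.card = i / A.card := by
        refine Nat.div_eq_of_lt_le ?_ ?_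
        · rw [mul_comm]; omega
        · rw [mul_comm, Nat.mul_succ]; omega
      simp only [e2]
      have : r i < r (i + 1) := by
        rw [Fin.lt_def]; simp only [r]; omega
      have := s.strictMono this
      linarith
    · have e1 : i + 1 = A.card * (i / A.card + 1) := by rw [Nat.mul_succ]; omega
      have e2 : (i + 1) / A.card = i / A.card + 1 := by
        conv_lhs => rw [e1]
        exact Nat.mul_div_cancel_left _ hm
      simp only [e2]
      have := hsub (r i) (r (i + 1))
      push_cast
      linarith
  · intro i
    have e : r (i + A.card) = r i := by simp [r]
    have e2 : (i + A.card) / A.card = i / A.card + 1 := Nat.add_div_right _ hm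
    simp only [e, e2]
    push_cast
    ring
  · intro i
    have e : r (i + A.card) = r i := by simp [r]
    simp only [e]
  · intro i
    have := (hray _ (hgH (r i))).add_int_mul ((i / A.card : ℕ) : ℤ)
    rw [hgα] at this
    exact this
  · intro x
    rw [← hH]
    constructor
    · intro hx
      have : α x ∈ Set.range s := by
        rw [Finset.range_orderEmbOfFin]
        exact Finset.mem_coe.2 (Finset.mem_image_of_mem α hx)
      obtain ⟨i, hi⟩ := this
      refine ⟨i, ?_⟩
      have hri : r i = i := Fin.ext (Nat.mod_eq_of_lt i.2)
      simp only [hri]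
      -- two hull points in the same direction coincide
      have h1 := hray x hx
      have h2 := hray _ (hgH i)
      rw [hgα, hi] at h2
      obtain ⟨p, hp, p0, p1⟩ := h1
      obtain ⟨q, hq, q0, q1⟩ := h2
      have hx' := mem_hullPoints_iff.1 ((hH x).1 hx)
      have hg' := mem_hullPoints_iff.1 ((hH _).1 (hgH i))
      rcases eq_or_mem_openSegment_of_ray (a := o) (b := x) (c := g i) (t := q / p)
        (by positivity) (by rw [q0, p0]; field_simp; ring) (by rw [q1, p1]; field_simp; ring) with
        h | h | h
      · exact h
      · exact absurd (mem_interior_of_mem_openSegment ho hx'.1 h) hg'.2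
      · exact absurd (mem_interior_of_mem_openSegment ho hg'.1 h) hx'.2
    · rintro ⟨i, rfl⟩
      exact hgH _

namespace HullCycle

variable {P : Finset Plane} {o : Plane} {m : ℕ} {h : ℕ → Plane} {θ : ℕ → ℝ}

theorem mem_hullPoints (H : HullCycle P o m h θ) (i : ℕ) : h i ∈ hullPoints P :=
  (H.mem_iff _).2 ⟨i, rfl⟩

theorem mem (H : HullCycle P o m h θ) (i : ℕ) : h i ∈ P := (H.mem_hullPoints i).1

theorem not_mem_interior (H : HullCycle P o m h θ) (i : ℕ) :
    h i ∉ _root_.interior (convexHull ℝ (P : Set Plane)) :=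
  (mem_hullPoints_iff.1 (H.mem_hullPoints i)).2

theorem shift (H : HullCycle P o m h θ) (k : ℕ) :
    HullCycle P o m (fun i => h (i + k)) (fun i => θ (i + k)) where
  interior := H.interior
  pos := H.pos
  mono := fun i j hij => H.mono (by omega)
  theta_add i := by
    have := H.theta_add (i + k)
    rwa [show i + k + m = i + m + k by ring] at this
  periodic i := by
    have := H.periodic (i + k)
    rwa [show i + k + m = i + m + k by ring] at this
  ray i := H.ray _
  mem_iff x := by
    rw [H.mem_iff]
    constructor
    · rintro ⟨i, rfl⟩
      -- Adding `k` periods first keeps the subtraction of `k` in the natural numbers.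
      refine ⟨i + k * m - k, ?_⟩
      have : k ≤ i + k * m := le_add_left (Nat.le_mul_of_pos_right k H.pos)
      rw [Nat.sub_add_cancel this]
      exact (H.periodic.nat_mul k) i
    · rintro ⟨i, rfl⟩
      exact ⟨_, rfl⟩

/-- Allows a hull point to be given an index in any chosen window of one period, which pins down its
unrolled angle. -/
theorem exists_rep (H : HullCycle P o m h θ) (k i : ℕ) :
    ∃ j, k ≤ j ∧ j < k + m ∧ j ≡ i [MOD m] ∧ h j = h i := by
  induction k with
  | zero => exact ⟨i % m, by omega, by simpa using Nat.mod_lt _ H.pos, Nat.mod_modEq _ _,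
      H.periodic.map_mod_nat i⟩
  | succ k ih =>
    obtain ⟨j, h1, h2, h3, h4⟩ := ih
    rcases h1.lt_or_eq with hlt | rfl
    · exact ⟨j, by omega, by omega, h3, h4⟩
    · have := H.pos
      exact ⟨k + m, by omega, by omega, by simpa [Nat.ModEq] using h3, by rw [H.periodic, h4]⟩

theorem theta_lt (H : HullCycle P o m h θ) {i j : ℕ} (hij : j < i + m) :
    θ j < θ i + 2 * Real.pi := by
  rw [← H.theta_add]; exact H.mono hij

theorem eq_iff (H : HullCycle P o m h θ) {i j : ℕ} : h i = h j ↔ i ≡ j [MOD m] := by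
  constructor
  · intro hij
    obtain ⟨k, h1, h2, h3, h4⟩ := H.exists_rep i j
    rcases h1.lt_or_eq with hlt | rfl
    · exfalso
      -- The cone degenerates to the ray through `h i`, and the angle of `h k` is strictly within
      -- one turn after it.
      refine OnRay.not_mem_cone (H.ray i) (H.ray i) (H.ray k) le_rfl
        (by linarith [Real.pi_pos]) (H.mono hlt) (H.theta_lt h2) (s := 1) (l := 1) (m := 0)
        zero_le_one zero_le_one le_rfl (by norm_num) ?_ ?_ <;> rw [h4, hij] <;> ring
    · exact h3
  · intro hij
    rw [← H.periodic.map_mod_nat i, ← H.periodic.map_mod_nat j, hij]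

theorem ne_of_lt (H : HullCycle P o m h θ) {i j : ℕ} (hij : i < j) (hj : j < i + m) :
    h i ≠ h j := by
  intro e
  have h1 := (Nat.modEq_iff_dvd' hij.le).1 (H.eq_iff.1 e)
  have := Nat.le_of_dvd (by omega) h1
  omega

theorem ncard_hullPoints (H : HullCycle P o m h θ) : (hullPoints P).ncard = m := by
  have e : hullPoints P = h '' (Finset.range m : Finset ℕ) := by
    ext x
    rw [H.mem_iff]
    constructor
    · rintro ⟨i, rfl⟩
      exact ⟨i % m, by simpa using Nat.mod_lt _ H.pos, H.periodic.map_mod_nat i⟩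
    · rintro ⟨i, -, rfl⟩
      exact ⟨i, rfl⟩
  rw [e, Set.InjOn.ncard_image, Set.ncard_coe_finset, Finset.card_range]
  intro i hi j hj hij
  simp only [Finset.coe_range, Set.mem_Iio] at hi hj
  have := H.eq_iff.1 hij
  rwa [Nat.ModEq, Nat.mod_eq_of_lt hi, Nat.mod_eq_of_lt hj] at this

theorem nonempty (H : HullCycle P o m h θ) : P.Nonempty := ⟨_, H.mem 0⟩

/-- Since `o` is interior, some hull point is strictly to the left of the ray through `h i`. Its
angle is within a half turn after `θ i`, and the next hull point comes no later. -/
theorem gap (H : HullCycle P o m h θ) (i : ℕ) : θ (i + 1) < θ i + Real.pi := by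
  have hne : o ≠ h i := fun e => H.not_mem_interior i (e ▸ H.interior)
  obtain ⟨y, hy, hlt⟩ := exists_lt_signedArea H.interior hne
  obtain ⟨z, hz, hmax⟩ := exists_hullPoint_max H.nonempty hne
  have hpos : 0 < signedArea o (h i) z := by
    have := hmax y hy
    simp only [signedArea_self_outer] at hlt
    linarith
  obtain ⟨j', rfl⟩ := (H.mem_iff z).1 hz
  obtain ⟨j, h1, h2, -, h4⟩ := H.exists_rep (i + 1) j'
  rw [← h4, OnRay.signedArea_pos_iff (H.ray i) (H.ray j)] at hpos
  have hle : θ j ≤ θ i + 2 * Real.pi := by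
    rw [← H.theta_add]; exact H.mono.monotone (by omega)
  have := sin_pos_imp_lt_pi (by linarith) hpos
  have := H.mono.monotone h1
  linarith

theorem signedArea_pos (H : HullCycle P o m h θ) (i : ℕ) :
    0 < signedArea o (h i) (h (i + 1)) := by
  rw [OnRay.signedArea_pos_iff (H.ray _) (H.ray _)]
  have := H.gap i
  have := H.mono (Nat.lt_succ_self i)
  exact Real.sin_pos_of_pos_of_lt_pi (by linarith) (by linarith)

/-- Fewer than three gaps below `π` cannot add up to a full turn. -/
theorem three_le (H : HullCycle P o m h θ) : 3 ≤ m := by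
  by_contra hcon
  have h0 := H.gap 0
  have h1 := H.gap 1
  have ht := H.theta_add 0
  have : m = 1 ∨ m = 2 := by have := H.pos; omega
  have := Real.pi_pos
  rcases ‹m = 1 ∨ m = 2› with rfl | rfl
  · simp only [zero_add] at *; linarith
  · simp only [zero_add] at *; norm_num at *; linarith

/-- No hull point is strictly between consecutive ones, seen from `o`. -/
theorem cone_empty (H : HullCycle P o m h θ) (i : ℕ) {y : Plane} (hy : y ∈ hullPoints P)
    (h1 : 0 < signedArea o (h i) y) (h2 : signedArea o (h (i + 1)) y < 0) : False := by
  obtain ⟨j', rfl⟩ := (H.mem_iff y).1 hy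
  -- In this window `θ (i + 1) ≤ θ j ≤ θ i + 2 * π`, so the two signs turn into the incompatible
  -- bounds `θ j < θ i + π` and `θ j > θ (i + 1) + π`.
  obtain ⟨j, k1, k2, -, k4⟩ := H.exists_rep (i + 1) j'
  rw [← k4, OnRay.signedArea_pos_iff (H.ray i) (H.ray j)] at h1
  rw [← k4, OnRay.signedArea_neg_iff (H.ray _) (H.ray j)] at h2
  have hle : θ j ≤ θ i + 2 * Real.pi := by
    rw [← H.theta_add]; exact H.mono.monotone (by omega)
  have a1 := sin_pos_imp_lt_pi (by linarith) h1
  have a2 := H.mono.monotone k1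
  have a3 := sin_neg_imp_pi_lt (by linarith) h2
  have := H.mono (Nat.lt_succ_self i)
  linarith [Real.pi_pos]

/-- Otherwise take the hull point `y` farthest on the wrong side. Seen from `o`, it is not strictly
between `h i` and `h (i + 1)`. If it lies on the far side of `h (i + 1)`, the triangle `o, h i, y`
shows that `h (i + 1)` is interior, and symmetrically for `h i`. -/
theorem support (H : HullCycle P o m h θ) (i : ℕ) {x : Plane} (hx : x ∈ P) :
    0 ≤ signedArea (h i) (h (i + 1)) x := by
  by_contra hcon
  have h3 := H.three_le
  have hne : h (i + 1) ≠ h i := (H.ne_of_lt (Nat.lt_succ_self i) (by omega)).symm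
  obtain ⟨y, hy, hmax⟩ := exists_hullPoint_max H.nonempty hne
  have hneg : signedArea (h i) (h (i + 1)) y < 0 := by
    have := hmax x hx
    rw [signedArea_swap (h i), signedArea_swap (h i)] at this
    linarith
  have hD := H.signedArea_pos i
  by_cases c1 : 0 ≤ signedArea o (h (i + 1)) y
  · have hE : signedArea o (h i) y = signedArea o (h i) (h (i + 1)) + signedArea o (h (i + 1)) y
        - signedArea (h i) (h (i + 1)) y := by unfold signedArea; ring
    have hE0 : 0 < signedArea o (h i) y := by linarith
    refine H.not_mem_interior (i + 1) (mem_interior_of_combo H.interior (H.mem i) hy.1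
      (β := signedArea o (h (i + 1)) y / signedArea o (h i) y)
      (γ := signedArea o (h i) (h (i + 1)) / signedArea o (h i) y)
      (by positivity) (by positivity) ?_ ?_ ?_)
    · rw [← add_div, div_lt_one hE0]; linarith
    · have := hE0.ne'
      field_simp; unfold signedArea; ring
    · have := hE0.ne'
      field_simp; unfold signedArea; ring
  by_cases c2 : signedArea o (h i) y ≤ 0
  · have c2' : 0 ≤ signedArea o y (h i) := by rw [signedArea_swap_right]; linarith
    have hE : signedArea o y (h (i + 1)) = signedArea o y (h i) + signedArea o (h i) (h (i + 1))
        - signedArea (h i) (h (i + 1)) y := by unfold signedArea; ring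
    have hE0 : 0 < signedArea o y (h (i + 1)) := by linarith
    refine H.not_mem_interior i (mem_interior_of_combo H.interior hy.1 (H.mem (i + 1))
      (β := signedArea o (h i) (h (i + 1)) / signedArea o y (h (i + 1)))
      (γ := signedArea o y (h i) / signedArea o y (h (i + 1)))
      (by positivity) (by positivity) ?_ ?_ ?_)
    · rw [← add_div, div_lt_one hE0]; linarith
    · have := hE0.ne'
      field_simp; unfold signedArea; ring
    · have := hE0.ne'
      field_simp; unfold signedArea; ring
  exact H.cone_empty i hy (not_le.1 c2) (not_le.1 c1)

theorem not_clockwise (H : HullCycle P o m h θ) (i : ℕ) {x : Plane} (hx : x ∈ P) :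
    ¬ Clockwise (h i) (h (i + 1)) x := not_lt.2 (H.support i hx)

theorem support_pos (H : HullCycle P o m h θ) (i : ℕ) {x : Plane}
    (hx : x ∈ _root_.interior (convexHull ℝ (P : Set Plane))) :
    0 < signedArea (h i) (h (i + 1)) x := by
  have h3 := H.three_le
  have hne : h (i + 1) ≠ h i := (H.ne_of_lt (Nat.lt_succ_self i) (by omega)).symm
  obtain ⟨y, hy, hlt⟩ := exists_lt_signedArea hx hne
  have := H.support i hy
  rw [signedArea_swap, signedArea_swap (h i)] at hlt
  linarith

/-- Such a point lies on a supporting line, so it is a hull point, yet its direction from `o` is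
strictly between two consecutive ones. -/
theorem not_mem_openSegment (H : HullCycle P o m h θ) (i : ℕ) {x : Plane} (hx : x ∈ P) :
    x ∉ openSegment ℝ (h i) (h (i + 1)) := by
  intro hmem
  obtain ⟨t, t0, t1, e0, e1⟩ := mem_openSegment_iff_coord.1 hmem
  have hz : signedArea (h i) (h (i + 1)) x = 0 := by unfold signedArea; rw [e0, e1]; ring
  have hull : x ∈ hullPoints P :=
    mem_hullPoints_iff.2 ⟨hx, fun hint => (H.support_pos i hint).ne' hz⟩
  have hD := H.signedArea_pos i
  refine H.cone_empty i hull ?_ ?_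
  · have : signedArea o (h i) x = t * signedArea o (h i) (h (i + 1)) := by
      unfold signedArea; rw [e0, e1]; ring
    rw [this]; positivity
  · have : signedArea o (h (i + 1)) x = - ((1 - t) * signedArea o (h i) (h (i + 1))) := by
      unfold signedArea; rw [e0, e1]; ring
    rw [this]
    have := mul_pos (sub_pos.2 t1) hD
    linarith

end HullCycle

/-! ### Three families of triangulations -/

/-- The closure of a ternary relation under rotation. -/
def Rotations {L : Type} (F : L → L → L → Prop) (a b c : L) : Prop :=
  F a b c ∨ F b c a ∨ F c a b

/-- The side `a b` of a face has a face on its other side, or it is on the hull. -/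
def HasOpposite {L : Type} {P : Finset Plane} (e : L → P) (F : L → L → L → Prop) (a b : L) : Prop :=
  (∃ a' b' c, Rotations F b' a' c ∧ e a' = e a ∧ e b' = e b) ∨
    ∀ d : P, ¬ Clockwise (e b : Plane) (e a) d

/-- Reduces the conditions to one representative of each face up to rotation, and phrases them in
labels. -/
theorem FaceSystem.of_labels {L : Type} {P : Finset Plane} {e : L → P} {F : L → L → L → Prop}
    (he : Function.Surjective e)
    (clockwise : ∀ a b c, F a b c → Clockwise (e a : Plane) (e b) (e c))
    (no_interior : ∀ a b c, F a b c → ∀ x : P, ¬ (Clockwise (e a : Plane) (e b) x ∧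
      Clockwise (e b : Plane) (e c) x ∧ Clockwise (e c : Plane) (e a) x))
    (no_point : ∀ a b c, F a b c → ∀ x : P, (x : Plane) ∉ openSegment ℝ (e a : Plane) (e b) ∧
      (x : Plane) ∉ openSegment ℝ (e b : Plane) (e c) ∧
      (x : Plane) ∉ openSegment ℝ (e c : Plane) (e a))
    (opposite : ∀ a b c, F a b c → HasOpposite e F a b ∧ HasOpposite e F b c ∧ HasOpposite e F c a)
    (exists_face : ∀ a, ∃ a' b c, Rotations F a' b c ∧ e a' = e a)
    (p q : L)
    (centres : ∀ a b c, Rotations F a b c →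
      (∀ d : P, ¬ Clockwise (e b : Plane) (e a) d) ∨ a = p ∨ b = p ∨ a = q ∨ b = q)
    (noncross : ∀ x y a b c d, e p ≠ e q → e x ≠ e q → e y ≠ e p → e x ≠ e y →
      e a = e p → e b = e q → (Rotations F a x c ∨ Rotations F x a c) →
      (Rotations F b y d ∨ Rotations F y b d) → MeetAtEnds (e p : Plane) (e x) (e q) (e y)) :
    FaceSystem (faceImage e (Rotations F)) where
  rotate := by
    rintro _ _ _ ⟨a, b, c, h, rfl, rfl, rfl⟩
    exact ⟨b, c, a, by unfold Rotations at *; tauto, rfl, rfl, rfl⟩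
  clockwise := by
    rintro _ _ _ ⟨a, b, c, h | h | h, rfl, rfl, rfl⟩
    · exact clockwise _ _ _ h
    · exact (clockwise _ _ _ h).rotate.rotate
    · exact (clockwise _ _ _ h).rotate
  no_interior := by
    rintro _ _ _ ⟨a, b, c, h | h | h, rfl, rfl, rfl⟩ x
    · exact no_interior _ _ _ h x
    · have := no_interior _ _ _ h x; tauto
    · have := no_interior _ _ _ h x; tauto
  no_point := by
    rintro _ _ _ ⟨a, b, c, h | h | h, rfl, rfl, rfl⟩ x
    · exact (no_point _ _ _ h x).1
    · exact (no_point _ _ _ h x).2.2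
    · exact (no_point _ _ _ h x).2.1
  opposite := by
    have key : ∀ a b, HasOpposite e F a b → (∃ d, faceImage e (Rotations F) (e b) (e a) d) ∨
        ∀ d : P, ¬ Clockwise (e b : Plane) (e a) d := by
      rintro a b (⟨a', b', c, h, h1, h2⟩ | h)
      · exact Or.inl ⟨e c, b', a', c, h, h2, h1, rfl⟩
      · exact Or.inr h
    rintro _ _ _ ⟨a, b, c, h | h | h, rfl, rfl, rfl⟩
    · exact key _ _ (opposite _ _ _ h).1
    · exact key _ _ (opposite _ _ _ h).2.2
    · exact key _ _ (opposite _ _ _ h).2.1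
  exists_face := by
    intro x
    obtain ⟨a, rfl⟩ := he x
    obtain ⟨a', b, c, h, h1⟩ := exists_face a
    exact ⟨e b, e c, a', b, c, h, h1, rfl, rfl⟩
  centres := by
    refine ⟨e p, e q, ?_, ?_⟩
    · rintro _ _ _ ⟨a, b, c, h, rfl, rfl, rfl⟩
      rcases centres a b c h with h | rfl | rfl | rfl | rfl
      · exact Or.inl h
      all_goals simp
    · intro _ _ h1 h2 h3 h4 hx hy
      have get : ∀ u v : P, (∃ c, faceImage e (Rotations F) u v c ∨ faceImage e (Rotations F) v u c) →
          ∃ a x c, (Rotations F a x c ∨ Rotations F x a c) ∧ e a = u ∧ e x = v := by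
        rintro u v ⟨c, ⟨a, b, c, h, rfl, rfl, rfl⟩ | ⟨a, b, c, h, rfl, rfl, rfl⟩⟩
        · exact ⟨a, b, c, Or.inl h, rfl, rfl⟩
        · exact ⟨b, a, c, Or.inr h, rfl, rfl⟩
      obtain ⟨a, x, c, h, ha, rfl⟩ := get _ _ hx
      obtain ⟨b, y, d, h', hb, rfl⟩ := get _ _ hy
      exact noncross x y a b c d h1 h2 h3 h4 ha hb h h'

namespace HullCycle

variable {P : Finset Plane} {o : Plane} {m : ℕ} {h : ℕ → Plane} {θ : ℕ → ℝ}

/-- The hull points as points of `P`. -/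
def pt (H : HullCycle P o m h θ) (i : ℕ) : P := ⟨h i, H.mem i⟩

theorem pt_eq_iff (H : HullCycle P o m h θ) {i j : ℕ} : H.pt i = H.pt j ↔ i ≡ j [MOD m] := by
  rw [← H.eq_iff]; exact Subtype.ext_iff

theorem not_mem_openSegment_of_interior (H : HullCycle P o m h θ) {z : Plane}
    (hz : z ∈ _root_.interior (convexHull ℝ (P : Set Plane))) (i : ℕ) {x : Plane}
    (hx : x ∈ hullPoints P) : x ∉ openSegment ℝ z (h i) := fun hmem =>
  (mem_hullPoints_iff.1 hx).2 (mem_interior_of_mem_openSegment hz (H.mem i) hmem)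

end HullCycle

/-- The faces of the star of a point `none` in a cycle. -/
inductive StarFace : Option ℕ → Option ℕ → Option ℕ → Prop
  | mk (i : ℕ) : StarFace none (some (i + 1)) (some i)

/-- The faces of the fan of the point `0` of a cycle of length `m`. -/
inductive FanFace (m : ℕ) : ℕ → ℕ → ℕ → Prop
  | mk (i : ℕ) (h1 : 1 ≤ i) (h2 : i + 1 < m) : FanFace m 0 (i + 1) i

/-! ### One internal point: the star triangulation. -/

section Star

variable {P : Finset Plane} {o : Plane} {m : ℕ} {h : ℕ → Plane} {θ : ℕ → ℝ}

/-- The labelling of `P` by its only internal point and its hull points. -/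
def starPt (H : HullCycle P o m h θ) (ho : o ∈ P) : Option ℕ → P
  | none => ⟨o, ho⟩
  | some i => H.pt i

theorem starPt_surjective (H : HullCycle P o m h θ) (ho : o ∈ P)
    (hP : ∀ x ∈ P, x = o ∨ x ∈ hullPoints P) : Function.Surjective (starPt H ho) := by
  rintro ⟨x, hx⟩
  rcases hP x hx with rfl | h
  · exact ⟨none, rfl⟩
  · obtain ⟨i, rfl⟩ := (H.mem_iff x).1 h
    exact ⟨some i, rfl⟩

theorem starPt_eq_iff (H : HullCycle P o m h θ) (ho : o ∈ P) (a b : Option ℕ) :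
    starPt H ho a = starPt H ho b ↔
      (a = none ∧ b = none) ∨ ∃ i j, a = some i ∧ b = some j ∧ i ≡ j [MOD m] := by
  have hne : ∀ i, H.pt i ≠ ⟨o, ho⟩ := fun i e =>
    H.not_mem_interior i (by rw [show h i = o from congrArg Subtype.val e]; exact H.interior)
  rcases a with _ | i <;> rcases b with _ | j
  · simp
  · simpa [starPt] using (hne j).symm
  · simpa [starPt] using hne i
  · simpa [starPt] using H.pt_eq_iff

theorem star_faceSystem (H : HullCycle P o m h θ) (ho : o ∈ P)
    (hP : ∀ x ∈ P, x = o ∨ x ∈ hullPoints P) :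
    FaceSystem (faceImage (starPt H ho) (Rotations StarFace)) := by
  have hcw : ∀ i, Clockwise o (h (i + 1)) (h i) := fun i => by
    rw [clockwise_iff, signedArea_swap_right]; have := H.signedArea_pos i; linarith
  have hnp : ∀ i, ∀ x ∈ P, x ∉ openSegment ℝ o (h i) := by
    intro i x hx hmem
    rcases hP x hx with rfl | hx
    · exact H.not_mem_interior i (left_mem_openSegment_iff.1 hmem ▸ H.interior)
    · exact H.not_mem_openSegment_of_interior H.interior i hx hmem
  refine FaceSystem.of_labels (starPt_surjective H ho hP) ?_ ?_ ?_ ?_ ?_ none none ?_ ?_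
  · rintro _ _ _ ⟨i⟩
    exact hcw i
  · rintro _ _ _ ⟨i⟩ ⟨x, hx⟩ ⟨h1, h2, h3⟩
    rcases hP x hx with rfl | hx
    · simp [clockwise_iff, starPt] at h1
    · exact (mem_hullPoints_iff.1 hx).2 (mem_interior_of_clockwise ho (H.mem _) (H.mem _) h1 h2 h3)
  · rintro _ _ _ ⟨i⟩ ⟨x, hx⟩
    refine ⟨hnp _ x hx, ?_, ?_⟩
    · rw [openSegment_symm]; exact H.not_mem_openSegment i hx
    · rw [openSegment_symm]; exact hnp _ x hx
  · rintro _ _ _ ⟨i⟩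
    -- The neighbouring face at `i` uses the label before `i`; the label `i + m` of the same point
    -- provides a predecessor even for `i = 0`.
    refine ⟨Or.inl ⟨none, some (i + 1), some (i + 2), Or.inr (Or.inl ⟨i + 1⟩), rfl, rfl⟩,
      Or.inr fun d => H.not_clockwise i d.2, Or.inl ⟨some (i + m), none, some (i + m - 1), ?_, ?_, rfl⟩⟩
    · have := H.pos
      obtain ⟨k, hk⟩ : ∃ k, i + m = k + 1 := ⟨i + m - 1, by omega⟩
      rw [hk, Nat.add_sub_cancel]
      exact Or.inl ⟨k⟩
    · exact H.pt_eq_iff.2 (by simp [Nat.ModEq])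
  · rintro (_ | i)
    · exact ⟨none, some 1, some 0, Or.inl ⟨0⟩, rfl⟩
    · exact ⟨some i, none, some (i + 1), Or.inr (Or.inl ⟨i⟩), rfl⟩
  · rintro a b c (⟨⟨i⟩⟩ | ⟨⟨i⟩⟩ | ⟨⟨i⟩⟩)
    · simp
    · simp
    · exact Or.inl fun d => H.not_clockwise i d.2
  · intro x y a b c d hne
    exact absurd rfl hne

theorem haveCompatibleTriangulations_star {Q : Finset Plane} {o' : Plane} {h' : ℕ → Plane}
    {θ' : ℕ → ℝ} (H : HullCycle P o m h θ) (ho : o ∈ P) (hP : ∀ x ∈ P, x = o ∨ x ∈ hullPoints P)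
    (H' : HullCycle Q o' m h' θ') (ho' : o' ∈ Q) (hQ : ∀ x ∈ Q, x = o' ∨ x ∈ hullPoints Q) :
    HaveCompatibleTriangulations P Q :=
  haveCompatibleTriangulations_of_labels (starPt_surjective H ho hP) (starPt_surjective H' ho' hQ)
    (fun a b => by rw [starPt_eq_iff, starPt_eq_iff]) (star_faceSystem H ho hP)
    (star_faceSystem H' ho' hQ)

end Star

/-! ### No internal points: the fan triangulation. -/

section Fan

variable {P : Finset Plane} {o : Plane} {m : ℕ} {h : ℕ → Plane} {θ : ℕ → ℝ}

theorem HullCycle.pt_surjective (H : HullCycle P o m h θ) (hP : ∀ x ∈ P, x ∈ hullPoints P) :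
    Function.Surjective H.pt := by
  rintro ⟨x, hx⟩
  obtain ⟨i, rfl⟩ := (H.mem_iff x).1 (hP x hx)
  exact ⟨i, rfl⟩

theorem fan_faceSystem (H : HullCycle P o m h θ) (hP : ∀ x ∈ P, x ∈ hullPoints P)
    (hfan : ∀ i, 1 ≤ i → i + 1 < m → 0 < signedArea (h 0) (h i) (h (i + 1))) :
    FaceSystem (faceImage H.pt (Rotations (FanFace m))) := by
  have hm := H.three_le
  have hm0 : h m = h 0 := by simpa using H.periodic 0
  have hnp : ∀ i, 1 ≤ i → i < m → ∀ x ∈ P, x ∉ openSegment ℝ (h 0) (h i) := by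
    intro i h1 h2 x hx hmem
    obtain ⟨j', rfl⟩ := (H.mem_iff x).1 (hP x hx)
    obtain ⟨j, -, hj, -, e⟩ := H.exists_rep 0 j'
    rw [← e] at hmem
    rcases Nat.eq_zero_or_pos j with rfl | hj0
    · exact H.ne_of_lt (i := 0) (j := i) (by omega) (by omega) (left_mem_openSegment_iff.1 hmem)
    obtain ⟨t, t0, t1, e0, e1⟩ := mem_openSegment_iff_coord.1 hmem
    -- a supporting edge ending at `h j` and not passing through `h 0`
    obtain ⟨k, hk, hk1, hk2⟩ : ∃ k, (k = j ∨ k + 1 = j) ∧ 1 ≤ k ∧ k + 1 < m := by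
      rcases Nat.lt_or_ge (j + 1) m with hlt | hge
      · exact ⟨j, Or.inl rfl, hj0, hlt⟩
      · exact ⟨j - 1, Or.inr (by omega), by omega, by omega⟩
    have hz : signedArea (h k) (h (k + 1)) (h j) = 0 := by
      rcases hk with rfl | rfl <;> simp
    have hpos : 0 < signedArea (h k) (h (k + 1)) (h 0) := by
      rw [signedArea_rotate]; exact hfan k hk1 hk2
    have hnn := H.support k (H.mem i)
    -- The value is zero at `h j`, but strictly between `h 0` and `h i` it is a positive combination
    -- of a positive and a nonnegative number.
    have : signedArea (h k) (h (k + 1)) (h j) = (1 - t) * signedArea (h k) (h (k + 1)) (h 0) +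
        t * signedArea (h k) (h (k + 1)) (h i) := by
      unfold signedArea; rw [e0, e1]; ring
    have := mul_pos (sub_pos.2 t1) hpos
    have := mul_nonneg t0.le hnn
    linarith
  refine FaceSystem.of_labels (H.pt_surjective hP) ?_ ?_ ?_ ?_ ?_ 0 0 ?_ ?_
  · rintro _ _ i ⟨_, h1, h2⟩
    rw [clockwise_iff, signedArea_swap_right]
    have := hfan i h1 h2
    simp only [HullCycle.pt]
    linarith
  · rintro _ _ i ⟨_, -, -⟩ ⟨x, hx⟩ ⟨h1, h2, h3⟩
    exact (mem_hullPoints_iff.1 (hP x hx)).2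
      (mem_interior_of_clockwise (H.mem _) (H.mem _) (H.mem _) h1 h2 h3)
  · rintro _ _ i ⟨_, h1, h2⟩ ⟨x, hx⟩
    refine ⟨hnp (i + 1) (by omega) h2 x hx, ?_, ?_⟩
    · rw [openSegment_symm]; exact H.not_mem_openSegment i hx
    · rw [openSegment_symm]; exact hnp i h1 (by omega) x hx
  · rintro _ _ i ⟨_, h1, h2⟩
    refine ⟨?_, Or.inr fun d => H.not_clockwise i d.2, ?_⟩
    · rcases Nat.lt_or_ge (i + 2) m with hlt | hge
      · exact Or.inl ⟨0, i + 1, i + 2, Or.inr (Or.inl ⟨i + 1, by omega, hlt⟩), rfl, rfl⟩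
      · refine Or.inr fun d => ?_
        have := H.not_clockwise (i + 1) d.2
        rwa [show i + 1 + 1 = m by omega, hm0] at this
    · rcases h1.lt_or_eq with hlt | rfl
      · obtain ⟨k, rfl⟩ : ∃ k, i = k + 1 := ⟨i - 1, by omega⟩
        exact Or.inl ⟨k + 1, 0, k, Or.inl ⟨k, by omega, by omega⟩, rfl, rfl⟩
      · exact Or.inr fun d => H.not_clockwise 0 d.2
  · intro i
    obtain ⟨j, -, hj, hmod, -⟩ := H.exists_rep 0 i
    have e := H.pt_eq_iff.2 hmod
    rcases Nat.eq_zero_or_pos j with rfl | hj0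
    · exact ⟨0, 2, 1, Or.inl ⟨1, le_rfl, by omega⟩, e⟩
    rcases Nat.lt_or_ge (j + 1) m with hlt | hge
    · exact ⟨j, 0, j + 1, Or.inr (Or.inl ⟨j, hj0, hlt⟩), e⟩
    · obtain ⟨k, rfl⟩ : ∃ k, j = k + 1 := ⟨j - 1, by omega⟩
      exact ⟨k + 1, k, 0, Or.inr (Or.inr ⟨k, by omega, by omega⟩), e⟩
  · rintro a b c (⟨⟨_, -, -⟩⟩ | ⟨⟨_, -, -⟩⟩ | ⟨⟨_, -, -⟩⟩)
    · simp
    · simp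
    · exact Or.inl fun d => H.not_clockwise b d.2
  · intro x y a b c d hne
    exact absurd rfl hne

theorem haveCompatibleTriangulations_fan {Q : Finset Plane} {o' : Plane} {h' : ℕ → Plane}
    {θ' : ℕ → ℝ} (H : HullCycle P o m h θ) (hP : ∀ x ∈ P, x ∈ hullPoints P)
    (hfan : ∀ i, 1 ≤ i → i + 1 < m → 0 < signedArea (h 0) (h i) (h (i + 1)))
    (H' : HullCycle Q o' m h' θ') (hQ : ∀ x ∈ Q, x ∈ hullPoints Q)
    (hfan' : ∀ i, 1 ≤ i → i + 1 < m → 0 < signedArea (h' 0) (h' i) (h' (i + 1))) :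
    HaveCompatibleTriangulations P Q :=
  haveCompatibleTriangulations_of_labels (H.pt_surjective hP) (H'.pt_surjective hQ)
    (fun a b => by rw [HullCycle.pt_eq_iff, HullCycle.pt_eq_iff]) (fan_faceSystem H hP hfan)
    (fan_faceSystem H' hQ hfan')

end Fan

/-! ### Two internal points -/

/-- The faces of a triangulation of a cycle of length `m` with two further points
`p = inl true` and `q = inl false`: `p` is joined to the points `0, 1, 2` of the cycle, and `q` is
joined to the points `2, …, m`. -/
inductive DoubleFace (m : ℕ) : Bool ⊕ ℕ → Bool ⊕ ℕ → Bool ⊕ ℕ → Prop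
  | p₁ : DoubleFace m (.inl true) (.inr 1) (.inr 0)
  | p₂ : DoubleFace m (.inl true) (.inr 2) (.inr 1)
  | pq₁ : DoubleFace m (.inl true) (.inr 0) (.inl false)
  | pq₂ : DoubleFace m (.inl true) (.inl false) (.inr 2)
  | q (j : ℕ) (h1 : 2 ≤ j) (h2 : j < m) : DoubleFace m (.inl false) (.inr (j + 1)) (.inr j)

/-- The points of `P` other than the hull points are `p` and `q`, and the direction `ψ` from `q` to
`p` is between the directions to the hull points `0` and `2`. -/
structure DoubleStar (P : Finset Plane) (p q : Plane) (m : ℕ) (h : ℕ → Plane) (θ : ℕ → ℝ)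
    (ψ : ℝ) : Prop where
  cycle : HullCycle P q m h θ
  mem_p : p ∈ internalPoints P
  mem_q : q ∈ P
  cases : ∀ x ∈ P, x = p ∨ x = q ∨ x ∈ hullPoints P
  ray : OnRay q ψ p
  lt_psi : θ 0 < ψ
  psi_lt : ψ < θ 2
  psi_lt_add : ψ < θ 0 + Real.pi
  lt_psi_add : θ 2 < ψ + Real.pi

namespace DoubleStar

variable {P : Finset Plane} {p q : Plane} {m : ℕ} {h : ℕ → Plane} {θ : ℕ → ℝ} {ψ : ℝ}

theorem ne (D : DoubleStar P p q m h θ ψ) : p ≠ q := by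
  obtain ⟨r, hr, h0, h1⟩ := D.ray
  rintro rfl
  have hc : r * Real.cos ψ = 0 := by linarith
  have hs : r * Real.sin ψ = 0 := by linarith
  have := Real.sin_sq_add_cos_sq ψ
  rw [(mul_eq_zero.1 hc).resolve_left hr.ne', (mul_eq_zero.1 hs).resolve_left hr.ne'] at this
  norm_num at this

/-- The labelling of `P`. -/
def label (D : DoubleStar P p q m h θ ψ) : Bool ⊕ ℕ → P
  | .inl true => ⟨p, D.mem_p.1⟩
  | .inl false => ⟨q, D.mem_q⟩
  | .inr i => D.cycle.pt i

theorem label_surjective (D : DoubleStar P p q m h θ ψ) : Function.Surjective D.label := by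
  rintro ⟨x, hx⟩
  rcases D.cases x hx with rfl | rfl | h
  · exact ⟨.inl true, rfl⟩
  · exact ⟨.inl false, rfl⟩
  · obtain ⟨i, rfl⟩ := (D.cycle.mem_iff x).1 h
    exact ⟨.inr i, rfl⟩

theorem hull_ne_p (D : DoubleStar P p q m h θ ψ) (i : ℕ) : h i ≠ p := fun e =>
  D.cycle.not_mem_interior i (e ▸ D.mem_p.2)

theorem hull_ne_q (D : DoubleStar P p q m h θ ψ) (i : ℕ) : h i ≠ q := fun e =>
  D.cycle.not_mem_interior i (e ▸ D.cycle.interior)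

theorem label_eq_iff (D : DoubleStar P p q m h θ ψ) (a b : Bool ⊕ ℕ) :
    D.label a = D.label b ↔
      (∃ s, a = .inl s ∧ b = .inl s) ∨ ∃ i j, a = .inr i ∧ b = .inr j ∧ i ≡ j [MOD m] := by
  have h1 : D.label (.inl true) ≠ D.label (.inl false) := fun e => D.ne (congrArg Subtype.val e)
  have h2 : ∀ s i, D.label (.inl s) ≠ D.label (.inr i) := by
    rintro (_ | _) i e
    · exact D.hull_ne_q i (congrArg Subtype.val e).symm
    · exact D.hull_ne_p i (congrArg Subtype.val e).symm
  rcases a with (_ | _) | i <;> rcases b with (_ | _) | j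
  · simp
  · simpa using h1.symm
  · simpa using h2 _ _
  · simpa using h1
  · simp
  · simpa using h2 _ _
  · simpa using (h2 _ _).symm
  · simpa using (h2 _ _).symm
  · have := D.cycle.pt_eq_iff (i := i) (j := j)
    simp only [reduceCtorEq, and_false, exists_false, false_or, Sum.inr.injEq]
    simpa using! this

theorem signedArea_zero_pos (D : DoubleStar P p q m h θ ψ) : 0 < signedArea q (h 0) p := by
  rw [OnRay.signedArea_pos_iff (D.cycle.ray _) D.ray]
  exact Real.sin_pos_of_pos_of_lt_pi (by linarith [D.lt_psi]) (by linarith [D.psi_lt_add])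

theorem signedArea_two_pos (D : DoubleStar P p q m h θ ψ) : 0 < signedArea q p (h 2) := by
  rw [OnRay.signedArea_pos_iff D.ray (D.cycle.ray _)]
  exact Real.sin_pos_of_pos_of_lt_pi (by linarith [D.psi_lt]) (by linarith [D.lt_psi_add])

theorem theta_le (D : DoubleStar P p q m h θ ψ) {j : ℕ} (hj : j ≤ m) :
    θ j ≤ θ 0 + 2 * Real.pi := by
  rw [← D.cycle.theta_add]; exact D.cycle.mono.monotone (by omega)

/-- `p` is not in the closed cones of the faces at `q`. -/
theorem not_mem_cone (D : DoubleStar P p q m h θ ψ) {i j : ℕ} (h2 : 2 ≤ i) (hij : i ≤ j)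
    (hji : j ≤ i + 1) (hj : j ≤ m) {β γ : ℝ} (hβ : 0 ≤ β) (hγ : 0 ≤ γ)
    (e0 : p 0 = q 0 + β * (h i 0 - q 0) + γ * (h j 0 - q 0))
    (e1 : p 1 = q 1 + β * (h i 1 - q 1) + γ * (h j 1 - q 1)) : False := by
  have hpos : 0 < β + γ := by
    rcases (add_nonneg hβ hγ).lt_or_eq with h | h
    · exact h
    · have hβ' : β = 0 := by linarith
      have hγ' : γ = 0 := by linarith
      subst hβ' hγ'
      exact absurd (Plane.ext (by linarith) (by linarith)) D.ne
  have m2 := D.cycle.mono.monotone h2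
  have mj := D.cycle.mono.monotone hij
  have mj' := D.cycle.mono.monotone hji
  have := D.cycle.gap i
  have := D.theta_le hj
  have := D.lt_psi
  have := D.psi_lt
  -- One turn later, the direction of `p` comes after `h j` and before the next occurrence of `h i`,
  -- as `not_mem_cone` requires.
  have hr := D.ray.add_int_mul 1
  refine OnRay.not_mem_cone (D.cycle.ray i) (D.cycle.ray j) hr mj (by linarith)
    (by push_cast; linarith) (by push_cast; linarith) zero_le_one hβ hγ hpos
    (by linarith) (by linarith)

/-- Seen from `q`, the segment from `p` to `h i` stays in the cone spanned by the directions of `p`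
and `h i`, and `h j` is outside this cone. The segments are therefore disjoint. -/
theorem meetAtEnds (D : DoubleStar P p q m h θ ψ) {i j : ℕ} (hi : i ≤ 2) (hj2 : 2 ≤ j)
    (hj : j ≤ m) (hne : h i ≠ h j) : MeetAtEnds p (h i) q (h j) := by
  intro z hz hz'
  exfalso
  obtain ⟨t, t0, t1, e0, e1⟩ := mem_segment_iff_coord.1 hz
  obtain ⟨s, s0, s1, g0, g1⟩ := mem_segment_iff_coord.1 hz'
  have hij : i < j := by
    rcases (hi.trans hj2).lt_or_eq with h | rfl
    · exact h
    · exact absurd rfl hne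
  have hjm : j < i + m := by
    rcases Nat.lt_or_ge j (i + m) with h | h'
    · exact h
    · obtain ⟨rfl, rfl⟩ : i = 0 ∧ j = m := ⟨by omega, by omega⟩
      exact absurd (by simpa using (D.cycle.periodic 0).symm) hne
  have a1 := D.cycle.mono hij
  have a2 := D.cycle.theta_lt hjm
  have a3 := D.cycle.mono.monotone hj2
  have a4 := D.theta_le hj
  have a5 := D.cycle.mono.monotone hi
  have a6 := D.cycle.mono.monotone (Nat.zero_le i)
  have b1 := D.lt_psi
  have b2 := D.psi_lt
  have b3 := D.psi_lt_add
  have b4 := D.lt_psi_add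
  rcases le_total ψ (θ i) with hle | hle
  · exact OnRay.not_mem_cone D.ray (D.cycle.ray i) (D.cycle.ray j) hle (by linarith) a1
      (by linarith) s0 (sub_nonneg.2 t1) t0 (by linarith) (by linarith) (by linarith)
  · exact OnRay.not_mem_cone (D.cycle.ray i) D.ray (D.cycle.ray j) hle (by linarith) (by linarith)
      a2 s0 t0 (sub_nonneg.2 t1) (by linarith) (by linarith) (by linarith)

theorem no_point_p (D : DoubleStar P p q m h θ ψ) {i : ℕ} (hi : i ≤ 2) {x : Plane} (hx : x ∈ P) :
    x ∉ openSegment ℝ p (h i) := by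
  intro hmem
  rcases D.cases x hx with rfl | rfl | hx
  · exact D.hull_ne_p i (left_mem_openSegment_iff.1 hmem).symm
  · obtain ⟨t, t0, t1, e0, e1⟩ := mem_openSegment_iff_coord.1 hmem
    -- If `q` were between `p` and `h i`, signed areas at `p` would have the same sign for `q` as
    -- for `h i`. For `i = 0` and `i = 2` they vanish for `h i`; for `i = 1` the supporting edge `h
    -- 0 h 1` gives the wrong sign.
    have c0 := D.signedArea_zero_pos
    have c2 := D.signedArea_two_pos
    have key : ∀ y : Plane, signedArea p y x = t * signedArea p y (h i) := by
      intro y; unfold signedArea; rw [e0, e1]; ring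
    have k0 : signedArea x (h 0) p = - signedArea p (h 0) x := by unfold signedArea; ring
    have k2 : signedArea x p (h 2) = signedArea p (h 2) x := by unfold signedArea; ring
    have p0 : 0 ≤ signedArea (h 0) (h 1) p := D.cycle.support 0 D.mem_p.1
    have p1 : 0 ≤ signedArea (h 1) (h 2) p := D.cycle.support 1 D.mem_p.1
    rw [k0, key] at c0
    rw [k2, key] at c2
    interval_cases i
    · simp at c0
    · have : signedArea p (h 0) (h 1) = signedArea (h 0) (h 1) p := (signedArea_rotate _ _ _).symm
      rw [this] at c0
      have := mul_nonneg t0.le p0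
      linarith
    · simp at c2
  · exact D.cycle.not_mem_openSegment_of_interior D.mem_p.2 i hx hmem

theorem no_point_q (D : DoubleStar P p q m h θ ψ) {j : ℕ} (hj2 : 2 ≤ j) (hj : j ≤ m) {x : Plane}
    (hx : x ∈ P) : x ∉ openSegment ℝ q (h j) := by
  intro hmem
  rcases D.cases x hx with rfl | rfl | hx
  · obtain ⟨t, t0, t1, e0, e1⟩ := mem_openSegment_iff_coord.1 hmem
    exact D.not_mem_cone hj2 le_rfl (Nat.le_succ j) hj t0.le le_rfl (by rw [e0]; ring)
      (by rw [e1]; ring)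
  · exact D.hull_ne_q j (left_mem_openSegment_iff.1 hmem).symm
  · exact D.cycle.not_mem_openSegment_of_interior D.cycle.interior j hx hmem

theorem no_point_pq (D : DoubleStar P p q m h θ ψ) {x : Plane} (hx : x ∈ P) :
    x ∉ openSegment ℝ p q := by
  intro hmem
  rcases D.cases x hx with rfl | rfl | hx
  · exact D.ne (left_mem_openSegment_iff.1 hmem)
  · exact D.ne (right_mem_openSegment_iff.1 hmem)
  · exact (mem_hullPoints_iff.1 hx).2 (mem_interior_of_mem_openSegment D.mem_p.2 D.mem_q hmem)

theorem no_point_hull (D : DoubleStar P p q m h θ ψ) (i : ℕ) {x : Plane} (hx : x ∈ P) :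
    x ∉ openSegment ℝ (h (i + 1)) (h i) := by
  rw [openSegment_symm]; exact D.cycle.not_mem_openSegment i hx

theorem clockwise (D : DoubleStar P p q m h θ ψ) {a b c : Bool ⊕ ℕ} (hF : DoubleFace m a b c) :
    Clockwise (D.label a : Plane) (D.label b) (D.label c) := by
  have hull : ∀ i z, z ∈ interior (convexHull ℝ (P : Set Plane)) → Clockwise z (h (i + 1)) (h i) := by
    intro i z hz
    have := D.cycle.support_pos i hz
    rw [clockwise_iff, signedArea_swap_right, ← signedArea_rotate]
    linarith
  cases hF with
  | p₁ => exact hull 0 p D.mem_p.2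
  | p₂ => exact hull 1 p D.mem_p.2
  | pq₁ =>
    have := D.signedArea_zero_pos
    change signedArea p (h 0) q < 0
    rw [← signedArea_rotate, signedArea_swap]; linarith [signedArea_rotate q (h 0) p]
  | pq₂ =>
    have := D.signedArea_two_pos
    change signedArea p q (h 2) < 0
    rw [signedArea_swap]; linarith
  | q j h1 h2 => exact hull j q D.cycle.interior

theorem no_interior (D : DoubleStar P p q m h θ ψ) {a b c : Bool ⊕ ℕ} (hF : DoubleFace m a b c)
    (x : P) : ¬ (Clockwise (D.label a : Plane) (D.label b) x ∧
      Clockwise (D.label b : Plane) (D.label c) x ∧ Clockwise (D.label c : Plane) (D.label a) x) := by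
  rintro ⟨h1, h2, h3⟩
  have hint := mem_interior_of_clockwise (D.label a).2 (D.label b).2 (D.label c).2 h1 h2 h3
  have hself : ∀ u v : Plane, ¬ Clockwise u v u ∧ ¬ Clockwise u v v := by simp [clockwise_iff]
  have c0 := D.signedArea_zero_pos
  have c2 := D.signedArea_two_pos
  rcases D.cases x x.2 with e | e | e
  · rw [e] at h1 h2 h3
    cases hF with
    | p₁ => exact (hself _ _).1 h1
    | p₂ => exact (hself _ _).1 h1
    | pq₁ => exact (hself _ _).1 h1
    | pq₂ => exact (hself _ _).1 h1
    | q j hj2 hj =>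
      have d1 : signedArea q (h (j + 1)) p < 0 := h1
      have d2 : signedArea (h (j + 1)) (h j) p < 0 := h2
      have d3 : signedArea (h j) q p < 0 := h3
      have hE := D.cycle.signedArea_pos j
      refine D.not_mem_cone (i := j) (j := j + 1) hj2 (by omega) le_rfl (by omega)
        (β := - signedArea q (h (j + 1)) p / signedArea q (h j) (h (j + 1)))
        (γ := - signedArea (h j) q p / signedArea q (h j) (h (j + 1)))
        (div_nonneg (by linarith) hE.le) (div_nonneg (by linarith) hE.le) ?_ ?_
      · have := hE.ne'
        field_simp; unfold signedArea; ring
      · have := hE.ne'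
        field_simp; unfold signedArea; ring
  · rw [e] at h1 h2 h3
    cases hF with
    | p₁ =>
      have d3 : signedArea (h 0) p q < 0 := h3
      rw [signedArea_rotate] at c0
      linarith [signedArea_rotate q (h 0) p, signedArea_rotate (h 0) p q]
    | p₂ =>
      have d1 : signedArea p (h 2) q < 0 := h1
      linarith [signedArea_rotate q p (h 2)]
    | pq₁ => exact (hself _ _).2 h2
    | pq₂ => exact (hself _ _).2 h1
    | q j hj2 hj => exact (hself _ _).1 h1
  · exact (mem_hullPoints_iff.1 e).2 hint

theorem no_point (D : DoubleStar P p q m h θ ψ) {a b c : Bool ⊕ ℕ} (hF : DoubleFace m a b c)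
    (x : P) : (x : Plane) ∉ openSegment ℝ (D.label a : Plane) (D.label b) ∧
      (x : Plane) ∉ openSegment ℝ (D.label b : Plane) (D.label c) ∧
      (x : Plane) ∉ openSegment ℝ (D.label c : Plane) (D.label a) := by
  have hx := x.2
  have h3 := D.cycle.three_le
  have hm0 : h m = h 0 := by simpa using D.cycle.periodic 0
  have q0 : (x : Plane) ∉ openSegment ℝ (h 0) q := by
    rw [openSegment_symm, ← hm0]; exact D.no_point_q (by omega) le_rfl hx
  have hp : ∀ i, i ≤ 2 → (x : Plane) ∉ openSegment ℝ (h i) p := fun i hi => by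
    rw [openSegment_symm]; exact D.no_point_p hi hx
  have hq : ∀ j, 2 ≤ j → j ≤ m → (x : Plane) ∉ openSegment ℝ (h j) q := fun j h2 hj => by
    rw [openSegment_symm]; exact D.no_point_q h2 hj hx
  cases hF with
  | p₁ => exact ⟨D.no_point_p (by omega) hx, D.no_point_hull 0 hx, hp 0 (by omega)⟩
  | p₂ => exact ⟨D.no_point_p (by omega) hx, D.no_point_hull 1 hx, hp 1 (by omega)⟩
  | pq₁ =>
    refine ⟨D.no_point_p (by omega) hx, q0, ?_⟩
    rw [openSegment_symm]; exact D.no_point_pq hx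
  | pq₂ =>
    exact ⟨D.no_point_pq hx, D.no_point_q le_rfl (by omega) hx, hp 2 le_rfl⟩
  | q j hj2 hj =>
    exact ⟨D.no_point_q (by omega) (by omega) hx, D.no_point_hull j hx, hq j hj2 (by omega)⟩

theorem hasOpposite (D : DoubleStar P p q m h θ ψ) {a b c : Bool ⊕ ℕ} (hF : DoubleFace m a b c) :
    HasOpposite D.label (DoubleFace m) a b ∧ HasOpposite D.label (DoubleFace m) b c ∧
      HasOpposite D.label (DoubleFace m) c a := by
  have h3 := D.cycle.three_le
  have hm0 : D.label (.inr m) = D.label (.inr 0) := D.cycle.pt_eq_iff.2 (by simp [Nat.ModEq])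
  have hull : ∀ i, HasOpposite D.label (DoubleFace m) (.inr (i + 1)) (.inr i) := fun i =>
    Or.inr fun d => D.cycle.not_clockwise i d.2
  have opp : ∀ {a b c}, Rotations (DoubleFace m) b a c → HasOpposite D.label (DoubleFace m) a b :=
    fun h => Or.inl ⟨_, _, _, h, rfl, rfl⟩
  cases hF with
  | p₁ => exact ⟨opp (Or.inr (Or.inl .p₂)), hull 0, opp (Or.inl .pq₁)⟩
  | p₂ => exact ⟨opp (Or.inr (Or.inl .pq₂)), hull 1, opp (Or.inl .p₁)⟩
  | pq₁ =>
    refine ⟨opp (Or.inr (Or.inl .p₁)), ?_, opp (Or.inl .pq₂)⟩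
    obtain ⟨k, hk⟩ : ∃ k, m = k + 1 := ⟨m - 1, by omega⟩
    -- Across the side from `h 0` to `q` is the last face at `q`, in which `h 0` carries the label
    -- `m`.
    refine Or.inl ⟨.inr m, .inl false, .inr k, Or.inl ?_, hm0, rfl⟩
    have := DoubleFace.q (m := m) k (by omega) (by omega)
    rwa [← hk] at this
  | pq₂ =>
    exact ⟨opp (Or.inr (Or.inl .pq₁)), opp (Or.inr (Or.inl (.q 2 le_rfl (by omega)))),
      opp (Or.inl .p₂)⟩
  | q j hj2 hj =>
    refine ⟨?_, hull j, ?_⟩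
    · rcases Nat.lt_or_ge (j + 1) m with hlt | hge
      · exact opp (Or.inr (Or.inl (.q (j + 1) (by omega) hlt)))
      · obtain rfl : m = j + 1 := by omega
        exact Or.inl ⟨.inl false, .inr 0, .inl true, Or.inr (Or.inr .pq₁), rfl, hm0.symm⟩
    · rcases hj2.lt_or_eq with hlt | rfl
      · obtain ⟨k, rfl⟩ : ∃ k, j = k + 1 := ⟨j - 1, by omega⟩
        exact opp (Or.inl (.q k (by omega) (by omega)))
      · exact opp (Or.inr (Or.inr .pq₂))

theorem faceSystem (D : DoubleStar P p q m h θ ψ) :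
    FaceSystem (faceImage D.label (Rotations (DoubleFace m))) := by
  have h3 := D.cycle.three_le
  have hm0 : D.label (.inr m) = D.label (.inr 0) := D.cycle.pt_eq_iff.2 (by simp [Nat.ModEq])
  have labelP : ∀ a, D.label a = D.label (.inl true) → a = .inl true := by
    intro a ha
    rcases (D.label_eq_iff _ _).1 ha with ⟨s, rfl, hs⟩ | ⟨i, j, -, hj, -⟩
    · exact hs.symm
    · cases hj
  have labelQ : ∀ a, D.label a = D.label (.inl false) → a = .inl false := by
    intro a ha
    rcases (D.label_eq_iff _ _).1 ha with ⟨s, rfl, hs⟩ | ⟨i, j, -, hj, -⟩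
    · exact hs.symm
    · cases hj
  refine FaceSystem.of_labels D.label_surjective (fun _ _ _ => D.clockwise)
    (fun _ _ _ => D.no_interior) (fun _ _ _ => D.no_point) (fun _ _ _ => D.hasOpposite) ?_
    (.inl true) (.inl false) ?_ ?_
  · rintro ((_ | _) | i)
    · exact ⟨.inl false, _, _, Or.inl (.q 2 le_rfl (by omega)), rfl⟩
    · exact ⟨.inl true, _, _, Or.inl .p₁, rfl⟩
    · obtain ⟨j, hj2, hj, hmod, -⟩ := D.cycle.exists_rep 2 i
      have e : D.label (.inr j) = D.label (.inr i) := D.cycle.pt_eq_iff.2 hmod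
      rcases Nat.lt_or_ge j m with hlt | hge
      · exact ⟨.inr j, _, _, Or.inr (Or.inl (.q j hj2 hlt)), e⟩
      rcases hge.lt_or_eq with hlt | rfl
      · obtain rfl : j = m + 1 := by omega
        refine ⟨.inr 1, _, _, Or.inr (Or.inl .p₂), ?_⟩
        rw [← e]
        exact D.cycle.pt_eq_iff.2 (by simp [Nat.ModEq])
      · exact ⟨.inr 0, _, _, Or.inr (Or.inl .p₁), by rw [← e, hm0]⟩
  · have hull : ∀ i, ∀ d : P, ¬ Clockwise (D.label (.inr i) : Plane) (D.label (.inr (i + 1))) d :=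
      fun i d => D.cycle.not_clockwise i d.2
    rintro a b c (h | h | h) <;> cases h <;> simp
    · exact fun d hd => hull 0 ⟨d, hd⟩
    · exact fun d hd => hull 1 ⟨d, hd⟩
    · exact fun d hd => hull _ ⟨d, hd⟩
  · intro x y a b c d hpq hxq hyp hxy ha hb hx hy
    obtain rfl := labelP a ha
    obtain rfl := labelQ b hb
    have hx' : ∃ i, i ≤ 2 ∧ x = .inr i := by
      rcases hx with (h | h | h) | (h | h | h) <;> cases h <;> simp at hxq ⊢
    have hy' : ∃ j, 2 ≤ j ∧ j ≤ m ∧ D.label y = D.label (.inr j) := by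
      rcases hy with (h | h | h) | (h | h | h) <;> cases h <;>
        first
        | exact absurd rfl hyp
        | exact ⟨m, by omega, le_rfl, hm0.symm⟩
        | exact ⟨_, by omega, by omega, rfl⟩
    obtain ⟨i, hi, rfl⟩ := hx'
    obtain ⟨j, hj2, hj, e⟩ := hy'
    rw [e] at hxy ⊢
    exact D.meetAtEnds hi hj2 hj fun e => hxy (Subtype.ext e)

theorem haveCompatibleTriangulations {Q : Finset Plane} {p' q' : Plane} {h' : ℕ → Plane}
    {θ' : ℕ → ℝ} {ψ' : ℝ} (D : DoubleStar P p q m h θ ψ) (D' : DoubleStar Q p' q' m h' θ' ψ') :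
    HaveCompatibleTriangulations P Q :=
  haveCompatibleTriangulations_of_labels D.label_surjective D'.label_surjective
    (fun a b => by rw [label_eq_iff, label_eq_iff]) D.faceSystem D'.faceSystem

/-- If `p` is on the segment from `q` to a hull point, the neighbours of that hull point are on
different sides of the line `p q`. -/
theorem of_ray (H : HullCycle P q m h θ) (hp : p ∈ internalPoints P) (hq : q ∈ P)
    (hP : ∀ x ∈ P, x = p ∨ x = q ∨ x ∈ hullPoints P) {i : ℕ} (hi : OnRay q (θ i) p) :
    ∃ h θ ψ, DoubleStar P p q m h θ ψ := by
  -- A positive index has a predecessor; shifting by it gives the hull point on the ray index 1, and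
  -- the gaps on both sides give the half-turn bounds.
  obtain ⟨j, hj, -, hmod, e⟩ := H.exists_rep 1 i
  obtain ⟨k, rfl⟩ : ∃ k, j = k + 1 := ⟨j - 1, by omega⟩
  have hray : OnRay q (θ (k + 1)) p := by
    obtain ⟨r, hr, r0, r1⟩ := hi
    obtain ⟨s, hs, s0, s1⟩ := H.ray i
    obtain ⟨t, ht, t0, t1⟩ := H.ray (k + 1)
    rw [e] at t0 t1
    have c0 : r * Real.cos (θ i) = (r * t / s) * Real.cos (θ (k + 1)) := by
      field_simp; linear_combination t0 - s0
    have c1 : r * Real.sin (θ i) = (r * t / s) * Real.sin (θ (k + 1)) := by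
      field_simp; linear_combination t1 - s1
    exact ⟨r * t / s, by positivity, by rw [r0, c0], by rw [r1, c1]⟩
  refine ⟨_, _, θ (k + 1), H.shift k, hp, hq, hP, hray, ?_, ?_, ?_, ?_⟩
  · exact H.mono (by omega)
  · exact H.mono (by omega)
  · have := H.gap k
    simpa using this
  · have := H.gap (k + 1)
    rw [add_comm 2 k]; exact this

/-- The direction of `p` from `q` falls between two consecutive hull directions, and a third hull
point after or before them must complete the triple. If both choices break the half-turn bound, then
`m = 3` and a hull point is exactly opposite to `p`. In that case exchanging `p` and `q` puts the
second internal point on the ray to a hull point, which `of_ray` settles. -/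
theorem exists_of_internalPoints {m₀ : ℕ} (hm₀ : (hullPoints P).ncard = m₀)
    (hP : (internalPoints P).ncard = 2) :
    ∃ p q h θ ψ, DoubleStar P p q m₀ h θ ψ := by
  obtain ⟨p, q, hpq, hint⟩ := Set.ncard_eq_two.1 hP
  have hp : p ∈ internalPoints P := by rw [hint]; simp
  have hq : q ∈ internalPoints P := by rw [hint]; simp
  have hall : ∀ x ∈ P, x = p ∨ x = q ∨ x ∈ hullPoints P := by
    intro x hx
    rcases mem_hullPoints_or_mem_internalPoints hx with h | h
    · exact Or.inr (Or.inr h)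
    · rw [hint] at h
      rcases h with rfl | rfl <;> simp
  obtain ⟨m, h, θ, H⟩ := exists_hullCycle hq.2
  obtain rfl : m = m₀ := by rw [← H.ncard_hullPoints, hm₀]
  have hm := H.three_le
  have hpi := Real.pi_pos
  obtain ⟨ψ, hψ, hray⟩ : ∃ ψ, θ 1 ≤ ψ ∧ OnRay q ψ p := by
    obtain ⟨ψ, hray⟩ := OnRay.exists_of_ne hpq
    obtain ⟨k, hk⟩ := exists_nat_ge ((θ 1 - ψ) / (2 * Real.pi))
    refine ⟨_, ?_, hray.add_int_mul k⟩
    rw [div_le_iff₀ (by linarith)] at hk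
    push_cast
    linarith
  -- the hull points around the direction of `p`
  obtain ⟨i, hi, hi'⟩ : ∃ i, θ (i + 1) ≤ ψ ∧ ψ < θ (i + 2) := by
    have hex : ∃ n, ψ < θ n := by
      obtain ⟨k, hk⟩ := exists_nat_gt ((ψ - θ 0) / (2 * Real.pi))
      have : ∀ k : ℕ, θ (k * m) = θ 0 + k * (2 * Real.pi) := by
        intro k
        induction k with
        | zero => simp
        | succ k ih => rw [Nat.succ_mul, H.theta_add, ih]; push_cast; ring
      refine ⟨k * m, ?_⟩
      rw [div_lt_iff₀ (by linarith)] at hk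
      rw [this]; linarith
    classical
    have h1 := Nat.find_spec hex
    -- The choice `θ 1 ≤ ψ` leaves room for the indices `i` and `i + 1` below the first angle
    -- exceeding `ψ`.
    have h2 : 1 < Nat.find hex := by
      by_contra hc
      have := H.mono.monotone (not_lt.1 hc)
      linarith
    refine ⟨Nat.find hex - 2, ?_, ?_⟩
    · exact not_lt.1 (Nat.find_min hex (m := Nat.find hex - 2 + 1) (by omega))
    · rwa [Nat.sub_add_cancel h2]
  rcases hi.lt_or_eq with hlt | heq
  swap
  · rw [← heq] at hray
    obtain ⟨h, θ, ψ, D⟩ := of_ray H hp hq.1 hall hray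
    exact ⟨p, q, h, θ, ψ, D⟩
  have g0 := H.gap i
  have g1 := H.gap (i + 1)
  have g2 := H.gap (i + 2)
  have o0 := H.mono (Nat.lt_succ_self i)
  have o2 := H.mono (Nat.lt_succ_self (i + 2))
  by_cases c1 : θ (i + 3) < ψ + Real.pi
  · refine ⟨p, q, _, _, ψ, H.shift (i + 1), hp, hq.1, hall, hray, ?_, ?_, ?_, ?_⟩
    · simpa using hlt
    · rw [show 2 + (i + 1) = i + 3 by ring]
      exact hi'.trans o2
    · rw [zero_add]; exact hi'.trans g1
    · rwa [show 2 + (i + 1) = i + 3 by ring]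
  by_cases c2 : ψ < θ i + Real.pi
  · refine ⟨p, q, _, _, ψ, H.shift i, hp, hq.1, hall, hray, ?_, ?_, ?_, ?_⟩
    · rw [zero_add]; exact o0.trans hlt
    · rwa [add_comm 2 i]
    · rwa [zero_add]
    · rw [add_comm 2 i]; exact g1.trans (by linarith)
  -- otherwise there are three hull points, and one is opposite to `p`
  have hθ : θ (i + m) ≤ θ (i + 3) := by
    rw [H.theta_add]; linarith
  obtain rfl : m = 3 := by
    have := H.mono.le_iff_le.1 hθ
    omega
  have hopp : θ (i + 3) = ψ + Real.pi := by
    have := H.theta_add i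
    linarith
  obtain ⟨n, h', θ', H'⟩ := exists_hullCycle hp.2
  obtain rfl : n = 3 := by rw [← H'.ncard_hullPoints, hm₀]
  obtain ⟨j, hj⟩ := (H'.mem_iff _).1 (H.mem_hullPoints (i + 3))
  have hq' : OnRay p (θ' j) q := by
    obtain ⟨r, hr, r0, r1⟩ := H'.ray j
    obtain ⟨s, hs, s0, s1⟩ := H.ray (i + 3)
    obtain ⟨t, ht, t0, t1⟩ := hray
    rw [hj] at r0 r1
    rw [hopp, Real.cos_add_pi] at s0
    rw [hopp, Real.sin_add_pi] at s1
    refine ⟨t * r / (s + t), by positivity, ?_, ?_⟩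
    · field_simp; linear_combination t * r0 - t * s0 - s * t0
    · field_simp; linear_combination t * r1 - t * s1 - s * t1
  obtain ⟨h, θ, ψ, D⟩ := of_ray H' hq hp.1 (fun x hx => by
    rcases hall x hx with h | h | h
    · exact Or.inr (Or.inl h)
    · exact Or.inl h
    · exact Or.inr (Or.inr h)) hq'
  exact ⟨q, p, h, θ, ψ, D⟩

end DoubleStar

/-! ### Few internal points -/

theorem haveCompatibleTriangulations_of_one_internalPoint {P Q : Finset Plane}
    (hh : (hullPoints P).ncard = (hullPoints Q).ncard) (hP : (internalPoints P).ncard = 1)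
    (hQ : (internalPoints Q).ncard = 1) : HaveCompatibleTriangulations P Q := by
  have key : ∀ {P : Finset Plane}, (internalPoints P).ncard = 1 →
      ∃ o ∈ P, (∃ m h θ, HullCycle P o m h θ) ∧ ∀ x ∈ P, x = o ∨ x ∈ hullPoints P := by
    intro P hP
    obtain ⟨o, hint⟩ := Set.ncard_eq_one.1 hP
    have ho : o ∈ internalPoints P := by rw [hint]; simp
    refine ⟨o, ho.1, exists_hullCycle ho.2, fun x hx => ?_⟩
    rcases mem_hullPoints_or_mem_internalPoints hx with h | h
    · exact Or.inr h
    · rw [hint] at h; exact Or.inl h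
  obtain ⟨o, ho, ⟨m, h, θ, H⟩, hP⟩ := key hP
  obtain ⟨o', ho', ⟨m', h', θ', H'⟩, hQ⟩ := key hQ
  obtain rfl : m = m' := by rw [← H.ncard_hullPoints, hh, H'.ncard_hullPoints]
  exact haveCompatibleTriangulations_star H ho hP H' ho' hQ

theorem haveCompatibleTriangulations_of_two_internalPoints {P Q : Finset Plane}
    (hh : (hullPoints P).ncard = (hullPoints Q).ncard) (hP : (internalPoints P).ncard = 2)
    (hQ : (internalPoints Q).ncard = 2) : HaveCompatibleTriangulations P Q := by
  obtain ⟨p, q, h, θ, ψ, D⟩ := DoubleStar.exists_of_internalPoints rfl hP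
  obtain ⟨p', q', h', θ', ψ', D'⟩ := DoubleStar.exists_of_internalPoints hh.symm hQ
  exact D.haveCompatibleTriangulations D'

theorem haveCompatibleTriangulations_of_internalPoints {P Q : Finset Plane}
    (hc : P.card = Q.card) (hh : (hullPoints P).ncard = (hullPoints Q).ncard)
    (hP : (internalPoints P).ncard = 1 ∨ (internalPoints P).ncard = 2) :
    HaveCompatibleTriangulations P Q := by
  have h1 := ncard_hullPoints_add_ncard_internalPoints (P := P)
  have h2 := ncard_hullPoints_add_ncard_internalPoints (P := Q)
  rcases hP with hP | hP
  · exact haveCompatibleTriangulations_of_one_internalPoint hh hP (by omega)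
  · exact haveCompatibleTriangulations_of_two_internalPoints hh hP (by omega)

theorem exists_clockwise_of_not_collinear {P : Finset Plane} (hP : ¬ Collinear ℝ (P : Set Plane)) :
    ∃ a ∈ P, ∃ b ∈ P, ∃ c ∈ P, Clockwise a b c := by
  by_contra hcon
  push Not at hcon
  apply hP
  rcases P.eq_empty_or_nonempty with rfl | ⟨a, ha⟩
  · simpa using collinear_empty ℝ Plane
  by_cases hs : ∀ b ∈ P, b = a
  · refine (collinear_iff_of_mem (k := ℝ) (p₀ := a) ha).2 ⟨0, fun b hb => ⟨0, ?_⟩⟩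
    simpa using hs b hb
  push Not at hs
  obtain ⟨b, hb, hba⟩ := hs
  refine (collinear_iff_of_mem (k := ℝ) (p₀ := a) ha).2 ⟨b - a, fun c hc => ?_⟩
  have h1 := hcon a ha b hb c hc
  have h2 := hcon b hb a ha c hc
  rw [clockwise_iff] at h1 h2
  rw [signedArea_swap] at h2
  obtain ⟨r, h0, h1⟩ := exists_param_of_signedArea_eq_zero hba.symm (z := c) (by linarith)
  exact ⟨r, Plane.ext (by simp [h0]; ring) (by simp [h1]; ring)⟩

/-- The centroid of a nondegenerate triangle of `P` works. It need not belong to `P`, and is used as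
viewpoint when there is no internal point. -/
theorem exists_mem_interior_of_not_collinear {P : Finset Plane}
    (hP : ¬ Collinear ℝ (P : Set Plane)) : ∃ o, o ∈ interior (convexHull ℝ (P : Set Plane)) := by
  obtain ⟨a, ha, b, hb, c, hc, h⟩ := exists_clockwise_of_not_collinear hP
  rw [clockwise_iff] at h
  have e0 : ((1 / 3 : ℝ) • (a + b + c)) 0 = (a 0 + b 0 + c 0) / 3 := by simp; ring
  have e1 : ((1 / 3 : ℝ) • (a + b + c)) 1 = (a 1 + b 1 + c 1) / 3 := by simp; ring
  refine ⟨(1 / 3 : ℝ) • (a + b + c), mem_interior_of_clockwise ha hb hc ?_ ?_ ?_⟩ <;>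
  · rw [clockwise_iff]
    unfold signedArea at *
    rw [e0, e1]
    linarith

/-! ### No internal points -/

/-- A set of vertices of a 5-cycle that meets every chord has three consecutive elements. -/
theorem five_cycle_cover {a b c d e : Prop} (h0 : a ∨ d) (h1 : b ∨ e) (h2 : c ∨ a) (h3 : d ∨ b)
    (h4 : e ∨ c) (k0 : a → b → ¬ c) (k1 : b → c → ¬ d) (k2 : c → d → ¬ e) (k3 : d → e → ¬ a)
    (k4 : e → a → ¬ b) : False := by
  by_cases a <;> by_cases b <;> by_cases c <;> simp_all

namespace HullCycle

variable {P : Finset Plane} {o : Plane} {m : ℕ} {h : ℕ → Plane} {θ : ℕ → ℝ}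

theorem exists_signedArea_pos (H : HullCycle P o m h θ) (i : ℕ) :
    ∃ j, j < m ∧ 0 < signedArea (h i) (h (i + 1)) (h (i + j)) := by
  have h3 := H.three_le
  have hne : h i ≠ h (i + 1) := H.ne_of_lt (Nat.lt_succ_self i) (by omega)
  obtain ⟨y, hy, hlt⟩ := exists_lt_signedArea H.interior hne
  obtain ⟨z, hz, hmax⟩ := exists_hullPoint_max H.nonempty hne
  obtain ⟨j', rfl⟩ := (H.mem_iff z).1 hz
  obtain ⟨j, k1, k2, -, e⟩ := H.exists_rep i j'
  refine ⟨j - i, by omega, ?_⟩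
  rw [Nat.add_sub_cancel' k1, e]
  have := H.support_pos i H.interior
  have := hmax y hy
  linarith

/-- Flat corners at `m - 2` consecutive hull points carry the line of one edge along to all `m` of
them, but some hull point is strictly off this line. -/
theorem not_forall_flat (H : HullCycle P o m h θ) (i : ℕ)
    (hflat : ∀ j, j + 2 < m → signedArea (h (i + j)) (h (i + j + 1)) (h (i + j + 2)) = 0) :
    False := by
  have h3 := H.three_le
  have key : ∀ j, (j + 1 < m → signedArea (h i) (h (i + 1)) (h (i + j)) = 0 ∧
      signedArea (h i) (h (i + 1)) (h (i + j + 1)) = 0) := by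
    intro j
    induction j with
    | zero => intro _; simp
    | succ j ih =>
      intro hj
      obtain ⟨k1, k2⟩ := ih (by omega)
      refine ⟨k2, ?_⟩
      have hne : h (i + j) ≠ h (i + j + 1) := H.ne_of_lt (Nat.lt_succ_self _) (by omega)
      obtain ⟨r, e0, e1⟩ := exists_param_of_signedArea_eq_zero hne (hflat j (by omega))
      have : signedArea (h i) (h (i + 1)) (h (i + j + 2)) =
          (1 - r) * signedArea (h i) (h (i + 1)) (h (i + j)) +
            r * signedArea (h i) (h (i + 1)) (h (i + j + 1)) := by
        unfold signedArea; rw [e0, e1]; ring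
      rw [k1, k2] at this
      rw [show i + (j + 1) + 1 = i + j + 2 by ring, this]
      ring
  obtain ⟨j, hj, hpos⟩ := H.exists_signedArea_pos i
  rcases Nat.lt_or_ge (j + 1) m with hlt | hge
  · exact hpos.ne' (key j hlt).1
  · obtain ⟨k, rfl⟩ : ∃ k, j = k + 1 := ⟨j - 1, by omega⟩
    exact hpos.ne' (key k (by omega)).2

/-- The two areas are the corners at the neighbours of `h k`. If no `k` worked, the flat corners
would meet every pair at distance two in the cycle; for `m ≤ 5` this yields `m - 2` consecutive flat
corners. -/
theorem exists_not_flat (H : HullCycle P o m h θ) (hm : m ≤ 5) :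
    ∃ k, signedArea (h k) (h (k + 1)) (h (k + 2)) ≠ 0 ∧
      signedArea (h (k + m - 2)) (h (k + m - 1)) (h (k + m)) ≠ 0 := by
  by_contra hcon
  push Not at hcon
  have h3 := H.three_le
  have hcon' : ∀ k, signedArea (h k) (h (k + 1)) (h (k + 2)) = 0 ∨
      signedArea (h (k + m - 2)) (h (k + m - 1)) (h (k + m)) = 0 := fun k => by
    have := hcon k; tauto
  have hper : ∀ k, signedArea (h (k + m)) (h (k + m + 1)) (h (k + m + 2)) =
      signedArea (h k) (h (k + 1)) (h (k + 2)) := by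
    intro k
    rw [show k + m + 1 = k + 1 + m by ring, show k + m + 2 = k + 2 + m by ring, H.periodic,
      H.periodic, H.periodic]
  obtain rfl | rfl | rfl : m = 3 ∨ m = 4 ∨ m = 5 := by omega
  · have key : ∀ i, signedArea (h i) (h (i + 1)) (h (i + 2)) ≠ 0 := fun i hi =>
      H.not_forall_flat i fun j hj => by
        obtain rfl : j = 0 := by omega
        exact hi
    exact (hcon' 0).elim (key 0) (key 1)
  · have key : ∀ i, signedArea (h i) (h (i + 1)) (h (i + 2)) = 0 →
        signedArea (h (i + 1)) (h (i + 2)) (h (i + 3)) ≠ 0 := fun i h1 h2 =>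
      H.not_forall_flat i fun j hj => by
        obtain rfl | rfl : j = 0 ∨ j = 1 := by omega
        · exact h1
        · exact h2
    have k0 := key 0
    have k1 := key 1
    have k2 := key 2
    have k3 := key 3
    have c0 := hcon' 0
    have c1 := hcon' 1
    have p0 := hper 0
    simp only [Nat.reduceAdd, Nat.reduceSub, zero_add] at *
    rw [p0] at k3
    tauto
  · have key : ∀ i, signedArea (h i) (h (i + 1)) (h (i + 2)) = 0 →
        signedArea (h (i + 1)) (h (i + 2)) (h (i + 3)) = 0 →
        signedArea (h (i + 2)) (h (i + 3)) (h (i + 4)) ≠ 0 := fun i h1 h2 h3 =>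
      H.not_forall_flat i fun j hj => by
        obtain rfl | rfl | rfl : j = 0 ∨ j = 1 ∨ j = 2 := by omega
        · exact h1
        · exact h2
        · exact h3
    have k0 := key 0
    have k1 := key 1
    have k2 := key 2
    have k3 := key 3
    have k4 := key 4
    have c0 := hcon' 0
    have c1 := hcon' 1
    have c2 := hcon' 2
    have c3 := hcon' 3
    have c4 := hcon' 4
    have p0 := hper 0
    have p1 := hper 1
    have p2 := hper 2
    simp only [Nat.reduceAdd, Nat.reduceSub, zero_add] at *
    rw [p0] at k3 k4
    rw [p1] at k4
    rw [p0] at c2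
    rw [p1] at c3
    rw [p2] at c4
    exact five_cycle_cover c0 c1 c2 c3 c4 k0 k1 k2 k3 k4

/-- Nonflat corners at both neighbours of the apex make the first and last triangles proper. Only
for `m = 5` is there another one, `0 2 3`. If it were degenerate, the two corners would force the
apex strictly between the points 2 and 3, inside a hull edge. -/
theorem exists_fan (H : HullCycle P o m h θ) (hm : m ≤ 5) :
    ∃ h θ, HullCycle P o m h θ ∧
      ∀ i, 1 ≤ i → i + 1 < m → 0 < signedArea (h 0) (h i) (h (i + 1)) := by
  obtain ⟨k, c1, c2⟩ := H.exists_not_flat hm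
  refine ⟨_, _, H.shift k, ?_⟩
  have H' := H.shift k
  have h3 := H.three_le
  have c1' : signedArea (h (0 + k)) (h (1 + k)) (h (2 + k)) ≠ 0 := by
    rwa [zero_add, add_comm 1, add_comm 2]
  have c2' : signedArea (h (m - 2 + k)) (h (m - 1 + k)) (h (m + k)) ≠ 0 := by
    rwa [show m - 2 + k = k + m - 2 by omega, show m - 1 + k = k + m - 1 by omega, add_comm m]
  generalize hg : (fun i => h (i + k)) = g at *
  have hg' : ∀ i, h (i + k) = g i := fun i => congrFun hg i
  simp only [hg'] at c1' c2' ⊢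
  generalize (fun i => θ (i + k)) = θ' at H'
  have hgm : g m = g 0 := by simpa using H'.periodic 0
  rw [hgm] at c2'
  have p0 := H'.support 0 (H'.mem 2)
  intro i hi1 hi2
  rcases hi1.lt_or_eq with hlt | rfl
  swap
  · exact lt_of_le_of_ne p0 c1'.symm
  rcases Nat.lt_or_ge (i + 2) m with hlt' | hge
  swap
  · obtain rfl : i = m - 2 := by omega
    rw [show m - 1 = m - 2 + 1 by omega] at c2'
    rw [← signedArea_rotate]
    exact lt_of_le_of_ne (H'.support _ (H'.mem 0)) c2'.symm
  obtain ⟨rfl, rfl⟩ : i = 2 ∧ m = 5 := ⟨by omega, by omega⟩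
  rw [← signedArea_rotate]
  refine lt_of_le_of_ne (H'.support 2 (H'.mem 0)) fun hz => ?_
  have hne : g 2 ≠ g 3 := H'.ne_of_lt (by omega) (by omega)
  obtain ⟨r, e0, e1⟩ := exists_param_of_signedArea_eq_zero hne hz.symm
  have p1 := H'.support 1 (H'.mem 3)
  have p3 := H'.support 3 (H'.mem 2)
  have p3' := H'.support 3 (H'.mem 0)
  simp only [Nat.reduceAdd, Nat.reduceSub, zero_add] at *
  have n1 : 0 < signedArea (g 0) (g 1) (g 2) := lt_of_le_of_ne p0 c1'.symm
  have n3 : 0 < signedArea (g 3) (g 4) (g 0) := lt_of_le_of_ne p3' c2'.symm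
  have f1 : signedArea (g 0) (g 1) (g 2) = r * signedArea (g 1) (g 2) (g 3) := by
    rw [← signedArea_rotate (g 0)]; unfold signedArea; rw [e0, e1]; ring
  have f3 : signedArea (g 3) (g 4) (g 0) = (1 - r) * signedArea (g 3) (g 4) (g 2) := by
    unfold signedArea; rw [e0, e1]; ring
  have r0 : 0 < r := by
    by_contra hc
    have := mul_nonpos_of_nonpos_of_nonneg (not_lt.1 hc) p1
    linarith
  have r1 : r < 1 := by
    by_contra hc
    have := mul_nonpos_of_nonpos_of_nonneg (sub_nonpos.2 (not_lt.1 hc)) p3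
    linarith
  exact H'.not_mem_openSegment 2 (H'.mem 0) (mem_openSegment_iff_coord.2 ⟨r, r0, r1, e0, e1⟩)

end HullCycle

/-- At least three of the at most five points are on the hull, so only zero, one or two internal
points can occur. -/
theorem haveCompatibleTriangulations_of_card_le_five {P Q : Finset Plane} (hc : P.card = Q.card)
    (h5 : P.card ≤ 5) (hP : ¬ Collinear ℝ (P : Set Plane)) (hQ : ¬ Collinear ℝ (Q : Set Plane))
    (hh : (hullPoints P).ncard = (hullPoints Q).ncard) : HaveCompatibleTriangulations P Q := by
  obtain ⟨o, ho⟩ := exists_mem_interior_of_not_collinear hP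
  obtain ⟨o', ho'⟩ := exists_mem_interior_of_not_collinear hQ
  obtain ⟨m, h, θ, H⟩ := exists_hullCycle ho
  obtain ⟨m', h', θ', H'⟩ := exists_hullCycle ho'
  obtain rfl : m = m' := by rw [← H.ncard_hullPoints, hh, H'.ncard_hullPoints]
  have h3 := H.three_le
  have k1 := ncard_hullPoints_add_ncard_internalPoints (P := P)
  have k2 := ncard_hullPoints_add_ncard_internalPoints (P := Q)
  have k3 := H.ncard_hullPoints
  rcases Nat.eq_zero_or_pos (internalPoints P).ncard with hz | hpos
  swap
  · exact haveCompatibleTriangulations_of_internalPoints hc hh (by omega)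
  have hull : ∀ {R : Finset Plane}, (internalPoints R).ncard = 0 → ∀ x ∈ R, x ∈ hullPoints R := by
    intro R hR x hx
    rw [Set.ncard_eq_zero (R.finite_toSet.subset fun _ h => h.1)] at hR
    exact (mem_hullPoints_or_mem_internalPoints hx).resolve_right (by rw [hR]; simp)
  obtain ⟨g, _, G, hfan⟩ := H.exists_fan (by omega)
  obtain ⟨g', _, G', hfan'⟩ := H'.exists_fan (by omega)
  exact haveCompatibleTriangulations_fan G (hull hz) hfan G' (hull (by omega)) hfan'

/-! ### Point sets with a unique triangulation -/

/-- Betweenness as a collinearity and a negative scalar product, both polynomial, so that it can be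
decided for integral coordinates. -/
theorem mem_openSegment_iff_signedArea {a b x : Plane} (hab : a ≠ b) :
    x ∈ openSegment ℝ a b ↔ signedArea a b x = 0 ∧
      (a 0 - x 0) * (b 0 - x 0) + (a 1 - x 1) * (b 1 - x 1) < 0 := by
  have hN : 0 < (b 0 - a 0) ^ 2 + (b 1 - a 1) ^ 2 := normSq_sub_pos hab
  rw [mem_openSegment_iff_coord]
  constructor
  · rintro ⟨t, t0, t1, e0, e1⟩
    refine ⟨by unfold signedArea; rw [e0, e1]; ring, ?_⟩
    have := mul_pos (mul_pos t0 (sub_pos.2 t1)) hN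
    rw [e0, e1]
    linarith
  · rintro ⟨hz, hlt⟩
    obtain ⟨r, e0, e1⟩ := exists_param_of_signedArea_eq_zero hab hz
    have hr : 0 < r * (1 - r) := by
      by_contra hc
      have := mul_nonpos_of_nonpos_of_nonneg (not_lt.1 hc) hN.le
      rw [e0, e1] at hlt
      linarith
    refine ⟨r, ?_, ?_, e0, e1⟩ <;> nlinarith

theorem mem_convexHull_triple_iff_signedArea {a b c x : Plane} (h : Clockwise a b c) :
    x ∈ convexHull ℝ {a, b, c} ↔
      signedArea a b x ≤ 0 ∧ signedArea b c x ≤ 0 ∧ signedArea c a x ≤ 0 := by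
  rw [clockwise_iff] at h
  rw [mem_convexHull_triple_iff_coord]
  constructor
  · rintro ⟨β, γ, hβ, hγ, hs, e0, e1⟩
    have k1 : signedArea a b x = γ * signedArea a b c := by
      unfold signedArea; rw [e0, e1]; ring
    have k2 : signedArea b c x = (1 - β - γ) * signedArea a b c := by
      unfold signedArea; rw [e0, e1]; ring
    have k3 : signedArea c a x = β * signedArea a b c := by
      unfold signedArea; rw [e0, e1]; ring
    rw [k1, k2, k3]
    exact ⟨mul_nonpos_of_nonneg_of_nonpos hγ h.le,
      mul_nonpos_of_nonneg_of_nonpos (by linarith) h.le, mul_nonpos_of_nonneg_of_nonpos hβ h.le⟩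
  · rintro ⟨h1, h2, h3⟩
    have hD : signedArea a b c = signedArea a b x + signedArea b c x + signedArea c a x := by
      unfold signedArea; ring
    refine ⟨signedArea c a x / signedArea a b c, signedArea a b x / signedArea a b c,
      div_nonneg_of_nonpos h3 h.le, div_nonneg_of_nonpos h1 h.le, ?_, ?_, ?_⟩
    · rw [← add_div, div_le_one_of_neg h]; linarith
    · have := h.ne
      field_simp; unfold signedArea; ring
    · have := h.ne
      field_simp; unfold signedArea; ring

theorem segment_disjoint_of_signedArea {a b c d x : Plane}
    (h : 0 < signedArea a b c * signedArea a b d) (hx : x ∈ segment ℝ a b) :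
    x ∉ segment ℝ c d := by
  intro hy
  obtain ⟨s, s0, s1, e0, e1⟩ := mem_segment_iff_coord.1 hx
  obtain ⟨t, t0, t1, g0, g1⟩ := mem_segment_iff_coord.1 hy
  have hz : (1 - t) * signedArea a b c + t * signedArea a b d = 0 := by
    have e : signedArea a b x = 0 := by unfold signedArea; rw [e0, e1]; ring
    rw [← e]; unfold signedArea; rw [g0, g1]; ring
  have h1 : (1 - t) * (signedArea a b c * signedArea a b d) + t * signedArea a b d ^ 2 = 0 := by
    linear_combination signedArea a b d * hz
  have h2 := mul_nonneg (sub_nonneg.2 t1) h.le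
  have h3 : t * signedArea a b d ^ 2 = 0 := by
    have := mul_nonneg t0 (sq_nonneg (signedArea a b d))
    linarith
  have h4 : signedArea a b d ≠ 0 := by
    intro e
    simp [e] at h
  have h5 : t = 0 := (mul_eq_zero.1 h3).resolve_right (pow_ne_zero 2 h4)
  rw [h5] at h1
  linarith

/-- Separation by a horizontal line covers segments on a common line, for which every signed area
vanishes. -/
theorem segment_disjoint_of_lt {a b c d x : Plane} (hac : c 1 < a 1) (had : d 1 < a 1)
    (hbc : c 1 < b 1) (hbd : d 1 < b 1) (hx : x ∈ segment ℝ a b) : x ∉ segment ℝ c d := by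
  intro hy
  obtain ⟨s, s0, s1, e0, e1⟩ := mem_segment_iff_coord.1 hx
  obtain ⟨t, t0, t1, g0, g1⟩ := mem_segment_iff_coord.1 hy
  have h1 : min (a 1) (b 1) ≤ x 1 := by
    rw [e1]; rcases le_total (a 1) (b 1) with h | h <;> simp only [h, inf_of_le_left, inf_of_le_right] <;>
      nlinarith
  have h2 : x 1 ≤ max (c 1) (d 1) := by
    rw [g1]; rcases le_total (c 1) (d 1) with h | h <;> simp only [h, sup_of_le_left, sup_of_le_right] <;>
      nlinarith
  have : max (c 1) (d 1) < min (a 1) (b 1) := by simp [*]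
  linarith

/-! ### Decidable criteria for points with integral coordinates. -/

namespace IntConfig

variable {n : ℕ} (f : Fin n → ℤ × ℤ)

/-- Twice the signed area of a triangle with integral vertices. -/
def area (i j k : Fin n) : ℤ :=
  ((f j).1 - (f i).1) * ((f k).2 - (f i).2) - ((f j).2 - (f i).2) * ((f k).1 - (f i).1)

/-- No point is in the relative interior of the segment `i j`. -/
def Visible (i j : Fin n) : Prop :=
  i ≠ j ∧ ∀ k, ¬ (area f i j k = 0 ∧
    ((f i).1 - (f k).1) * ((f j).1 - (f k).1) + ((f i).2 - (f k).2) * ((f j).2 - (f k).2) < 0)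

instance : DecidableRel (Visible f) := fun _ _ => inferInstanceAs (Decidable (_ ∧ _))

/-- A criterion for two segments without common endpoints to be disjoint. -/
def Separated (i j k l : Fin n) : Prop :=
  0 < area f i j k * area f i j l ∨ 0 < area f k l i * area f k l j ∨
    ((f k).2 < (f i).2 ∧ (f l).2 < (f i).2 ∧ (f k).2 < (f j).2 ∧ (f l).2 < (f j).2) ∨
    ((f i).2 < (f k).2 ∧ (f j).2 < (f k).2 ∧ (f i).2 < (f l).2 ∧ (f j).2 < (f l).2)

instance (i j k l : Fin n) : Decidable (Separated f i j k l) :=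
  inferInstanceAs (Decidable (_ ∨ _))

/-- The triangle `i j k` is clockwise and empty, and its sides contain no further point. -/
def Triangle (i j k : Fin n) : Prop :=
  Visible f i j ∧ Visible f j k ∧ Visible f k i ∧ area f i j k < 0 ∧
    ∀ l, area f i j l ≤ 0 → area f j k l ≤ 0 → area f k i l ≤ 0 → l = i ∨ l = j ∨ l = k

instance (i j k : Fin n) : Decidable (Triangle f i j k) := inferInstanceAs (Decidable (_ ∧ _))

/-- The points of the plane with the given integral coordinates. -/
noncomputable def pt (i : Fin n) : Plane := !₂[((f i).1 : ℝ), ((f i).2 : ℝ)]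

variable {f}

theorem pt_injective (hf : Function.Injective f) : Function.Injective (pt f) := by
  intro i j hij
  have h0 := congrArg (fun x : Plane => x 0) hij
  have h1 := congrArg (fun x : Plane => x 1) hij
  simp only [pt, PiLp.toLp_apply, Matrix.cons_val_zero, Matrix.cons_val_one, Int.cast_inj] at h0 h1
  exact hf (Prod.ext h0 h1)

theorem signedArea_pt (i j k : Fin n) : signedArea (pt f i) (pt f j) (pt f k) = (area f i j k : ℝ) := by
  simp [signedArea, pt, area]

/-- The set of points. -/
noncomputable def pts (hf : Function.Injective f) : Finset Plane :=
  Finset.univ.map ⟨pt f, pt_injective hf⟩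

theorem card_pts (hf : Function.Injective f) : (pts hf).card = n := by
  simp [pts]

theorem mem_pts (hf : Function.Injective f) {x : Plane} : x ∈ pts hf ↔ ∃ i, pt f i = x := by
  simp [pts]

/-- The labelling of the points. -/
noncomputable def equiv (hf : Function.Injective f) : Fin n ≃ pts hf :=
  Equiv.ofBijective (fun i => ⟨pt f i, (mem_pts hf).2 ⟨i, rfl⟩⟩)
    ⟨fun _ _ h => pt_injective hf (congrArg Subtype.val h), fun ⟨_, hx⟩ => by
      obtain ⟨i, rfl⟩ := (mem_pts hf).1 hx
      exact ⟨i, rfl⟩⟩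

theorem mem_openSegment_pt_iff (hf : Function.Injective f) {i j k : Fin n} (hij : i ≠ j) :
    pt f k ∈ openSegment ℝ (pt f i) (pt f j) ↔ area f i j k = 0 ∧
      ((f i).1 - (f k).1) * ((f j).1 - (f k).1) + ((f i).2 - (f k).2) * ((f j).2 - (f k).2) < 0 := by
  rw [mem_openSegment_iff_signedArea (fun h => hij (pt_injective hf h)), signedArea_pt]
  simp only [pt, PiLp.toLp_apply, Matrix.cons_val_zero, Matrix.cons_val_one]
  norm_cast

theorem visible_iff (hf : Function.Injective f) {i j : Fin n} (hij : i ≠ j) :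
    Visible f i j ↔ ∀ k, pt f k ∉ openSegment ℝ (pt f i) (pt f j) := by
  unfold Visible
  simp only [mem_openSegment_pt_iff hf hij]
  exact and_iff_right hij

theorem visible_of_adj (hf : Function.Injective f) {T : SimpleGraph (pts hf)}
    (hT : IsNoncrossing _ T) {i j : Fin n} (h : T.Adj (equiv hf i) (equiv hf j)) :
    Visible f i j :=
  (visible_iff hf fun e => h.ne (congrArg _ e)).2 fun k => hT.no_point _ _ (equiv hf k) h

theorem Visible.symm (hf : Function.Injective f) {i j : Fin n} (h : Visible f i j) :
    Visible f j i := by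
  rw [visible_iff hf h.1.symm]
  intro k
  rw [openSegment_symm]
  exact (visible_iff hf h.1).1 h k

/-- The graph of all segments without further points. -/
noncomputable def visibilityGraph (hf : Function.Injective f) : SimpleGraph (pts hf) where
  Adj a b := Visible f ((equiv hf).symm a) ((equiv hf).symm b)
  symm := ⟨fun _ _ h => h.symm hf⟩
  loopless := ⟨fun _ h => h.1 rfl⟩

theorem meetAtEnds_of_separated {i j k l : Fin n} (h : Separated f i j k l) :
    MeetAtEnds (pt f i) (pt f j) (pt f k) (pt f l) := by
  intro x hx hy
  exfalso
  have e : ∀ i, pt f i 1 = ((f i).2 : ℝ) := fun i => by simp [pt]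
  rcases h with h | h | ⟨h1, h2, h3, h4⟩ | ⟨h1, h2, h3, h4⟩
  · refine segment_disjoint_of_signedArea ?_ hx hy
    rw [signedArea_pt, signedArea_pt]
    exact_mod_cast h
  · refine segment_disjoint_of_signedArea ?_ hy hx
    rw [signedArea_pt, signedArea_pt]
    exact_mod_cast h
  · refine segment_disjoint_of_lt ?_ ?_ ?_ ?_ hx hy <;> simp only [Int.cast_lt, *]
  · refine segment_disjoint_of_lt ?_ ?_ ?_ ?_ hy hx <;> simp only [Int.cast_lt, *]

theorem isNoncrossing_visibilityGraph (hf : Function.Injective f)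
    (hsep : ∀ i j k l, Visible f i j → Visible f k l →
      i = k ∨ i = l ∨ j = k ∨ j = l ∨ Separated f i j k l) : IsNoncrossing _ (visibilityGraph hf) := by
  have hvis : ∀ {i j}, Visible f i j → ∀ k, pt f k ∉ openSegment ℝ (pt f i) (pt f j) :=
    fun h => (visible_iff hf h.1).1 h
  constructor
  · intro a b p h
    obtain ⟨i, rfl⟩ := (equiv hf).surjective a
    obtain ⟨j, rfl⟩ := (equiv hf).surjective b
    obtain ⟨k, rfl⟩ := (equiv hf).surjective p
    simp only [visibilityGraph, Equiv.symm_apply_apply] at h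
    exact hvis h k
  · suffices H : ∀ i j k l, Visible f i j → Visible f k l → s(i, j) ≠ s(k, l) →
        MeetAtEnds (pt f i) (pt f j) (pt f k) (pt f l) by
      intro a b c d h h' hne x hx hy
      obtain ⟨i, rfl⟩ := (equiv hf).surjective a
      obtain ⟨j, rfl⟩ := (equiv hf).surjective b
      obtain ⟨k, rfl⟩ := (equiv hf).surjective c
      obtain ⟨l, rfl⟩ := (equiv hf).surjective d
      simp only [visibilityGraph, Equiv.symm_apply_apply] at h h'
      refine H i j k l h h' (fun e => hne ?_) x hx hy
      simpa using congrArg (Sym2.map (equiv hf)) e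
    have common : ∀ o i j, Visible f o i → Visible f o j → i ≠ j →
        MeetAtEnds (pt f o) (pt f i) (pt f o) (pt f j) := fun o i j hi hj hij =>
      meetAtEnds_of_common (fun e => hij (pt_injective hf e)) (hvis hj _) (hvis hi _)
    intro i j k l h h' hne
    by_cases h1 : i = k
    · subst h1
      exact common _ _ _ h h' fun e => hne (by rw [e])
    by_cases h2 : i = l
    · subst h2
      exact (common _ _ _ h (h'.symm hf) fun e => hne (by rw [e, Sym2.eq_swap])).swap_right
    by_cases h3 : j = k
    · subst h3
      exact (common _ _ _ (h.symm hf) h' fun e => hne (by rw [e, Sym2.eq_swap])).swap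
    by_cases h4 : j = l
    · subst h4
      exact (common _ _ _ (h.symm hf) (h'.symm hf) fun e => hne (by rw [e])).swap.swap_right
    exact meetAtEnds_of_separated ((hsep i j k l h h').resolve_left h1 |>.resolve_left h2
      |>.resolve_left h3 |>.resolve_left h4)

/-- Every triangulation is contained in the visibility graph. As this graph is itself noncrossing,
maximality gives equality. -/
theorem adj_iff_of_isTriangulation (hf : Function.Injective f)
    (hsep : ∀ i j k l, Visible f i j → Visible f k l →
      i = k ∨ i = l ∨ j = k ∨ j = l ∨ Separated f i j k l) {T : SimpleGraph (pts hf)} (hT : IsTriangulation _ T) {i j : Fin n} :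
    T.Adj (equiv hf i) (equiv hf j) ↔ Visible f i j := by
  refine ⟨visible_of_adj hf hT.1, fun h => ?_⟩
  have hle : T ≤ visibilityGraph hf := by
    intro a b hab
    obtain ⟨i, rfl⟩ := (equiv hf).surjective a
    obtain ⟨j, rfl⟩ := (equiv hf).surjective b
    simpa [visibilityGraph] using visible_of_adj hf hT.1 hab
  refine hT.2 (isNoncrossing_visibilityGraph hf hsep) hle ?_
  simpa [visibilityGraph] using h

theorem isClockwiseTriangle_iff (hf : Function.Injective f)
    (hsep : ∀ i j k l, Visible f i j → Visible f k l →
      i = k ∨ i = l ∨ j = k ∨ j = l ∨ Separated f i j k l) {T : SimpleGraph (pts hf)} (hT : IsTriangulation _ T) {i j k : Fin n} :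
    IsClockwiseTriangle T (equiv hf i) (equiv hf j) (equiv hf k) ↔ Triangle f i j k := by
  have hcw : Clockwise (pt f i) (pt f j) (pt f k) ↔ area f i j k < 0 := by
    rw [clockwise_iff, signedArea_pt]; norm_cast
  have hmem : ∀ l, area f i j k < 0 → (pt f l ∈ convexHull ℝ {pt f i, pt f j, pt f k} ↔
      area f i j l ≤ 0 ∧ area f j k l ≤ 0 ∧ area f k i l ≤ 0) := by
    intro l h
    rw [mem_convexHull_triple_iff_signedArea (hcw.2 h), signedArea_pt, signedArea_pt, signedArea_pt]
    norm_cast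
  constructor
  · rintro ⟨h1, h2, h3, h4, h5⟩
    have h4' := hcw.1 h4
    refine ⟨(adj_iff_of_isTriangulation hf hsep hT).1 h1, (adj_iff_of_isTriangulation hf hsep hT).1 h2,
      (adj_iff_of_isTriangulation hf hsep hT).1 h3, h4', fun l k1 k2 k3 => ?_⟩
    simpa using h5 (equiv hf l) ((hmem l h4').2 ⟨k1, k2, k3⟩)
  · rintro ⟨h1, h2, h3, h4, h5⟩
    refine ⟨(adj_iff_of_isTriangulation hf hsep hT).2 h1, (adj_iff_of_isTriangulation hf hsep hT).2 h2,
      (adj_iff_of_isTriangulation hf hsep hT).2 h3, hcw.2 h4, fun x hx => ?_⟩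
    obtain ⟨l, rfl⟩ := (equiv hf).surjective x
    obtain ⟨k1, k2, k3⟩ := (hmem l h4).1 hx
    simpa using h5 l k1 k2 k3

theorem not_collinear (hf : Function.Injective f) {i j k : Fin n} (h : area f i j k < 0) :
    ¬ Collinear ℝ (pts hf : Set Plane) := by
  intro hc
  obtain ⟨v, hv⟩ := (collinear_iff_of_mem (k := ℝ) (p₀ := pt f i)
    (Finset.mem_coe.2 ((mem_pts hf).2 ⟨i, rfl⟩))).1 hc
  obtain ⟨r, hr⟩ := hv (pt f j) (Finset.mem_coe.2 ((mem_pts hf).2 ⟨j, rfl⟩))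
  obtain ⟨s, hs⟩ := hv (pt f k) (Finset.mem_coe.2 ((mem_pts hf).2 ⟨k, rfl⟩))
  have h0 : signedArea (pt f i) (pt f j) (pt f k) = 0 := by
    rw [hr, hs]; simp [signedArea]; ring
  rw [signedArea_pt] at h0
  have : area f i j k = 0 := by exact_mod_cast h0
  omega

/-- Certificates for both kinds of points: strictly inside a triangle of the set, or maximal for an
affine function that would have no maximum at an interior point. -/
theorem ncard_hullPoints (hf : Function.Injective f) (S : Finset (Fin n)) (i j k : Fin n)
    (hint : ∀ l, l ∉ S → area f i j l < 0 ∧ area f j k l < 0 ∧ area f k i l < 0)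
    (hhull : ∀ l ∈ S, ∃ u v, u ≠ v ∧ ∀ w, area f u v w ≤ area f u v l) :
    (hullPoints (pts hf)).ncard = S.card := by
  have hmem : ∀ i, pt f i ∈ pts hf := fun i => (mem_pts hf).2 ⟨i, rfl⟩
  have e : hullPoints (pts hf) = pt f '' S := by
    ext x
    rw [mem_hullPoints_iff, mem_pts]
    constructor
    · rintro ⟨⟨l, rfl⟩, hl⟩
      refine ⟨l, by_contra fun hlS => hl ?_, rfl⟩
      obtain ⟨h1, h2, h3⟩ := hint l hlS
      refine mem_interior_of_clockwise (hmem i) (hmem j) (hmem k) ?_ ?_ ?_ <;>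
        rw [clockwise_iff, signedArea_pt] <;> exact_mod_cast ‹_›
    · rintro ⟨l, hl, rfl⟩
      refine ⟨⟨l, rfl⟩, fun hin => ?_⟩
      obtain ⟨u, v, huv, hle⟩ := hhull l hl
      obtain ⟨y, hy, hlt⟩ := exists_lt_signedArea hin fun e => huv (pt_injective hf e)
      obtain ⟨w, rfl⟩ := (mem_pts hf).1 hy
      rw [signedArea_pt, signedArea_pt] at hlt
      have := hle w
      have : area f u v l < area f u v w := by exact_mod_cast hlt
      omega
  rw [e, (pt_injective hf).injOn.ncard_image, Set.ncard_coe_finset]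

end IntConfig

/-- A triangle with three internal points on a line through a vertex. -/
def collinearConfig : Fin 6 → ℤ × ℤ := ![(0, 4), (3, 0), (-3, 0), (0, 3), (0, 2), (0, 1)]

/-- A triangle with three internal points, each on the line through a vertex and another internal
point. -/
def spiralConfig : Fin 6 → ℤ × ℤ := ![(-1, 0), (0, 2), (2, -1), (0, 0), (1, 0), (0, 1)]

-- The invariant is whether two vertices of some face together meet all faces. In `collinearConfig`
-- the base vertices 1 and 2 do, since the three internal points and the apex form a path whose
-- edges are joined to both. In `spiralConfig` every such pair misses a face. A compatible bijection
-- would carry the pair over.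
open IntConfig in
theorem exists_not_haveCompatibleTriangulations :
    ∃ P Q : Finset Plane, P.card = 6 ∧ Q.card = 6 ∧
      ¬ Collinear ℝ (P : Set Plane) ∧ ¬ Collinear ℝ (Q : Set Plane) ∧
      (hullPoints P).ncard = (hullPoints Q).ncard ∧
      ¬ HaveCompatibleTriangulations P Q := by
  have hf : Function.Injective collinearConfig := by decide +kernel
  have hg : Function.Injective spiralConfig := by decide +kernel
  refine ⟨pts hf, pts hg, card_pts hf, card_pts hg, not_collinear hf (i := 0) (j := 1) (k := 2) (by decide +kernel),
    not_collinear hg (i := 0) (j := 1) (k := 2) (by decide +kernel), ?_, ?_⟩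
  · rw [ncard_hullPoints hf {0, 1, 2} 0 1 2 (by decide +kernel) (by decide +kernel),
      ncard_hullPoints hg {0, 1, 2} 0 1 2 (by decide +kernel) (by decide +kernel)]
  rintro ⟨S, T, hS, hT, φ, hφ⟩
  have hSiff := fun i j k => isClockwiseTriangle_iff hf (by decide +kernel) hS (i := i) (j := j) (k := k)
  have hTiff := fun i j k => isClockwiseTriangle_iff hg (by decide +kernel) hT (i := i) (j := j) (k := k)
  let σ : Fin 6 ≃ Fin 6 := ((equiv hf).trans φ).trans (equiv hg).symm
  have hσ : ∀ i j k, Triangle collinearConfig i j k ↔ Triangle spiralConfig (σ i) (σ j) (σ k) := by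
    intro i j k
    rw [← hSiff, ← hTiff, hφ]
    simp [σ]
  -- two points of a face meet all faces of the first triangulation, but not of the second
  have h1 : Triangle collinearConfig 5 1 2 := by decide +kernel
  have h2 : ∀ i j k, Triangle collinearConfig i j k →
      i = 1 ∨ j = 1 ∨ k = 1 ∨ i = 2 ∨ j = 2 ∨ k = 2 := by decide +kernel
  have h3 : ∀ x y z, Triangle spiralConfig z x y → ∃ i j k, Triangle spiralConfig i j k ∧
      ¬ (i = x ∨ j = x ∨ k = x ∨ i = y ∨ j = y ∨ k = y) := by decide +kernel
  obtain ⟨i, j, k, hijk, hne⟩ := h3 _ _ _ ((hσ _ _ _).1 h1)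
  obtain ⟨i, rfl⟩ := σ.surjective i
  obtain ⟨j, rfl⟩ := σ.surjective j
  obtain ⟨k, rfl⟩ := σ.surjective k
  simp only [σ.apply_eq_iff_eq] at hne
  exact hne (h2 i j k ((hσ i j k).2 hijk))

theorem theorem1 :
    -- one or two internal points
    (∀ P Q : Finset Plane, P.card = Q.card →
      (hullPoints P).ncard = (hullPoints Q).ncard →
      ((internalPoints P).ncard = 1 ∨ (internalPoints P).ncard = 2) →
      ((internalPoints Q).ncard = 1 ∨ (internalPoints Q).ncard = 2) →
      HaveCompatibleTriangulations P Q) ∧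
    -- at most five points
    (∀ P Q : Finset Plane, P.card = Q.card → P.card ≤ 5 →
      ¬ Collinear ℝ (P : Set Plane) → ¬ Collinear ℝ (Q : Set Plane) →
      (hullPoints P).ncard = (hullPoints Q).ncard →
      HaveCompatibleTriangulations P Q) ∧
    -- five is best possible: there is a counterexample with six points
    (∃ P Q : Finset Plane, P.card = 6 ∧ Q.card = 6 ∧
      ¬ Collinear ℝ (P : Set Plane) ∧ ¬ Collinear ℝ (Q : Set Plane) ∧
      (hullPoints P).ncard = (hullPoints Q).ncard ∧
      ¬ HaveCompatibleTriangulations P Q) := by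
  exact ⟨fun _ _ hc hh hP _ => haveCompatibleTriangulations_of_internalPoints hc hh hP,
    fun _ _ hc h5 hP hQ hh => haveCompatibleTriangulations_of_card_le_five hc h5 hP hQ hh,
    exists_not_haveCompatibleTriangulations⟩
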